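/- Let $N$ be a lattice of rank $d$ and $N_{\mathbb R}=N\otimes_{\mathbb Z}\mathbb R$. Let $\Sigma$ be a rational simplicial fan in $N_{\mathbb R}$ (finitely many cones) which is complete, i.e. its support $|\Sigma|$ is $N_{\mathbb R}$. Let $\rho_1,\dots,\rho_r$ be its rays, with primitive integer generators $v_1,\dots,v_r\in N$, and fix $b_i=a_iv_i$ with $a_i$ a positive integer, for $i=1,\dots,r$. Let $\psi:|\Sigma|\to\mathbb R$ be the function that is $\mathbb Q$-linear on each cone of $\Sigma$ with $\psi(b_i)=1$ for all $i$, and put $Q=\{v\in|\Sigma| : \psi(v)\le 1\}$. Let $\lambda:|\Sigma|\to\mathbb R$ be a piecewise $\mathbb Q$-linear function with respect to $\Sigma$ (on each cone it is the restriction of a linear form on $N_{\mathbb R}$ taking rational values on $N$) such that $\lambda(b_i)>-1$ for $i=1,\dots,r$. For $v\in|\Sigma|\cap N$ set $w_\lambda(v)=\psi(v)-\lceil\psi(v)\rceil+\lambda(v)\in\mathbb Q$; for $k\in\mathbb Q$ and an integer $m\ge 0$ let $f^\lambda_k(m)$ be the number of $v\in mQ\cap N$ with $w_\lambda(v)=k$,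 and set $$\delta^\lambda_k(t)=(1-t)^{d+1}\sum_{m\ge0}f^\lambda_k(m)t^m\in\mathbb Z[[t]],\qquad \delta^\lambda(t)=\sum_{k\in\mathbb Q}\delta^\lambda_k(t)\,t^k .$$ Then $\delta^\lambda(t)$ is well defined (for each $q\in\mathbb Q$ only finitely many terms contribute to the coefficient of $t^q$), it lies in $\mathbb Z[[t^{1/M}]]$ for some positive integer $M$ and is there the expansion at $0$ of a rational function in $\mathbb Q(t^{1/M})$, and as rational functions in $t^{1/M}$ $$\delta^\lambda(t)=t^d\,\delta^\lambda(t^{-1}).$$ The last identity holds for every $M$ and every rational function in $\mathbb Q(t^{1/M})$ with expansion $\delta^\lambda(t)\in\mathbb Z[[t^{1/M}]]$. -/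

import Mathlib

open scoped TensorProduct Pointwise LaurentSeries

noncomputable section

namespace WeightedEhrhart

/-- The real vector space `N_ℝ = ℝ ⊗ N` of a lattice `N`. -/
abbrev RealSpace (N : Type*) [AddCommGroup N] : Type _ := ℝ ⊗[ℤ] N

/-- The canonical map `N → N_ℝ`. -/
def toReal {N : Type*} [AddCommGroup N] (v : N) : RealSpace N := (1 : ℝ) ⊗ₜ[ℤ] v

/-- A rational simplicial fan in `N_ℝ`: a finite set of rational simplicial cones (these are
automatically strongly convex), closed under passing to faces, in which any two cones meet along
a common face. -/
structure SimplicialFan (N : Type*) [AddCommGroup N] where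
  cones : Set (PointedCone ℝ (RealSpace N))
  finite_cones : cones.Finite
  rational : ∀ σ ∈ cones, ∃ s : Finset N, σ = PointedCone.hull ℝ (toReal '' (s : Set N))
  simplicial : ∀ σ ∈ cones, σ.IsSimplicial
  face_mem : ∀ σ ∈ cones, ∀ τ : PointedCone ℝ (RealSpace N), τ.IsFaceOf σ → τ ∈ cones
  inter_face : ∀ σ ∈ cones, ∀ τ ∈ cones, (σ ⊓ τ).IsFaceOf σ ∧ (σ ⊓ τ).IsFaceOf τ

namespace SimplicialFan

variable {N : Type*} [AddCommGroup N]

/-- The support `|Σ|`. -/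
def support (F : SimplicialFan N) : Set (RealSpace N) := {v | ∃ σ ∈ F.cones, v ∈ σ}

/-- The fan is complete if its support is all of `N_ℝ`. -/
def IsComplete (F : SimplicialFan N) : Prop := F.support = Set.univ

/-- The rays of the fan: its one-dimensional cones. -/
def Ray (F : SimplicialFan N) : Type _ :=
  {ρ : PointedCone ℝ (RealSpace N) //
    ρ ∈ F.cones ∧ Module.finrank ℝ (Submodule.span ℝ (ρ : Set (RealSpace N))) = 1}

/-- `f` is piecewise `ℚ`-linear with respect to the fan: on each cone it agrees with a linear
form on `N_ℝ` that takes rational values on `N`. Only the values of `f` on the support matter. -/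
def IsPiecewiseQLinear (F : SimplicialFan N) (f : RealSpace N → ℝ) : Prop :=
  ∀ σ ∈ F.cones, ∃ l : RealSpace N →ₗ[ℝ] ℝ,
    (∀ n : N, ∃ q : ℚ, l (toReal n) = q) ∧ ∀ v ∈ σ, f v = l v

end SimplicialFan

/-- `v` is the primitive integer generator of the ray `ρ`. -/
def IsPrimitiveGenerator {N : Type*} [AddCommGroup N] (ρ : PointedCone ℝ (RealSpace N)) (v : N) :
    Prop :=
  v ≠ 0 ∧ toReal v ∈ ρ ∧ ∀ w : N, toReal w ∈ ρ → ∃ n : ℕ, w = n • v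

/-- A stacky fan: a rational simplicial fan with, on each ray, a positive integer multiple of the
primitive integer generator. -/
structure StackyFan (N : Type*) [AddCommGroup N] extends SimplicialFan N where
  b : toSimplicialFan.Ray → N
  b_spec : ∀ ρ : toSimplicialFan.Ray, ∃ (v : N) (a : ℕ),
    IsPrimitiveGenerator ρ.1 v ∧ 0 < a ∧ b ρ = a • v

namespace StackyFan

variable {N : Type*} [AddCommGroup N]

theorem toReal_injective [Module.Free ℤ N] : Function.Injective (toReal : N → RealSpace N) := by
  intro x y h
  let B := Module.Free.chooseBasis ℤ N
  apply B.repr.injective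
  ext i
  have h2 : (Algebra.TensorProduct.basis ℝ B).repr (toReal x) i =
      (Algebra.TensorProduct.basis ℝ B).repr (toReal y) i := by rw [h]
  simpa [toReal, Algebra.TensorProduct.basis_repr_tmul] using h2

/-- A generator of a simplicial cone spans a face. -/
theorem hull_singleton_isFaceOf {E : Type*} [AddCommGroup E] [Module ℝ E] {s : Set E}
    (hs : LinearIndepOn ℝ id s) {g : E} (hg : g ∈ s) :
    (PointedCone.hull ℝ {g}).IsFaceOf (PointedCone.hull ℝ s) := by
  classical
  refine ⟨Submodule.span_mono (by simpa using hg), ?_⟩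
  intro x y a hx hy ha hxy
  obtain ⟨c, hcs, hc0, rfl⟩ := PointedCone.mem_hull_set.1 hx
  obtain ⟨e, hes, he0, rfl⟩ := PointedCone.mem_hull_set.1 hy
  obtain ⟨r, hr⟩ := Submodule.mem_span_singleton.1 hxy
  have key : a • c + e = Finsupp.single g (r : ℝ) := by
    have hinj := linearIndepOn_iff.1 hs (a • c + e - Finsupp.single g (r : ℝ)) ?_ ?_
    · exact sub_eq_zero.1 hinj
    · refine Submodule.sub_mem _ (Submodule.add_mem _ (Submodule.smul_mem _ _ ?_) ?_) ?_
      · exact hcs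
      · exact hes
      · exact Finsupp.single_mem_supported ℝ _ hg
    · simp only [map_sub, map_add, map_smul, Finsupp.linearCombination_single, id]
      rw [sub_eq_zero]
      exact hr.symm
  have hc : ∀ i, i ≠ g → c i = 0 := by
    intro i hi
    have h1 := DFunLike.congr_fun key i
    simp only [Finsupp.add_apply, Finsupp.smul_apply, smul_eq_mul,
      Finsupp.single_apply, if_neg hi.symm] at h1
    have h2 := hc0 i
    have h3 := he0 i
    have h4 := mul_nonneg ha.le h2
    have h5 : a * c i = 0 := by linarith
    rcases mul_eq_zero.1 h5 with h | h
    · exact absurd h ha.ne'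
    · exact h
  have hce : c = Finsupp.single g (c g) := by
    ext i
    by_cases hi : i = g
    · subst hi; simp
    · rw [hc i hi, Finsupp.single_apply, if_neg (Ne.symm hi)]
  rw [hce, Finsupp.sum_single_index (by simp)]
  exact PointedCone.smul_mem _ (hc0 g) (Submodule.subset_span rfl)

theorem b_ne_zero [Module.Free ℤ N] (S : StackyFan N) (ρ : S.Ray) : toReal (S.b ρ) ≠ 0 := by
  obtain ⟨v, a, hv, ha, hb⟩ := S.b_spec ρ
  have h0 : toReal (0 : N) = 0 := by simp [toReal]
  rw [← h0]
  refine toReal_injective.ne ?_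
  rw [hb, ← natCast_zsmul]
  exact smul_ne_zero (by exact_mod_cast ha.ne') hv.1

theorem b_mem (S : StackyFan N) (ρ : S.Ray) : toReal (S.b ρ) ∈ ρ.1 := by
  obtain ⟨v, a, hv, ha, hb⟩ := S.b_spec ρ
  have h : toReal (S.b ρ) = (a : ℝ) • toReal v := by
    rw [hb]
    simp [toReal, TensorProduct.smul_tmul', TensorProduct.tmul_smul]
  rw [h]
  exact PointedCone.smul_mem _ (Nat.cast_nonneg a) hv.2.1

/-- Every linearly independent generator of a cone of the fan spans a ray of the fan. -/
theorem exists_ray [Module.Free ℤ N] (S : StackyFan N) {s : Set (RealSpace N)}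
    (hs : LinearIndepOn ℝ id s) (hS : PointedCone.hull ℝ s ∈ S.cones) {g : RealSpace N}
    (hg : g ∈ s) :
    ∃ (ρ : S.Ray) (k : ℝ), ρ.1 = PointedCone.hull ℝ {g} ∧ 0 < k ∧ toReal (S.b ρ) = k • g := by
  have hg0 : g ≠ 0 := hs.ne_zero hg
  have hmem := S.face_mem _ hS _ (hull_singleton_isFaceOf hs hg)
  have hspan : Submodule.span ℝ ((PointedCone.hull ℝ {g} : PointedCone ℝ (RealSpace N)) :
      Set (RealSpace N)) = Submodule.span ℝ {g} := by
    apply le_antisymm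
    · exact Submodule.span_le.2 (PointedCone.hull_le_span ℝ {g})
    · exact Submodule.span_mono PointedCone.subset_hull
  let ρ : S.Ray := ⟨PointedCone.hull ℝ {g}, hmem, by rw [hspan]; exact finrank_span_singleton hg0⟩
  obtain ⟨k, hk⟩ := Submodule.mem_span_singleton.1 (S.b_mem ρ)
  refine ⟨ρ, k, rfl, ?_, hk.symm⟩
  refine lt_of_le_of_ne k.2 ?_
  intro h
  apply S.b_ne_zero ρ
  rw [← hk]
  have : k = 0 := Subtype.ext h.symm
  rw [this, zero_smul]

/-- A ray contained in a simplicial cone is spanned by one of its generators. -/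
theorem ray_eq [Module.Free ℤ N] (S : StackyFan N) {s : Set (RealSpace N)}
    (hs : LinearIndepOn ℝ id s) (hS : PointedCone.hull ℝ s ∈ S.cones) (ρ : S.Ray)
    (hρ : ρ.1 ≤ PointedCone.hull ℝ s) : ∃ g ∈ s, ρ.1 = PointedCone.hull ℝ {g} := by
  classical
  have hface : ρ.1.IsFaceOf (PointedCone.hull ℝ s) := by
    have := (S.inter_face _ ρ.2.1 _ hS).2
    rwa [inf_eq_left.2 hρ] at this
  obtain ⟨c, hcs, hc0, hc⟩ := PointedCone.mem_hull_set.1 (hρ (S.b_mem ρ))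
  have hcne : c ≠ 0 := by
    rintro rfl
    exact S.b_ne_zero ρ (by rw [← hc]; simp)
  obtain ⟨g, hg⟩ := Finsupp.support_nonempty_iff.2 hcne
  have hgs : g ∈ s := hcs hg
  have hgρ : g ∈ ρ.1 := by
    have hpos : 0 < c g := lt_of_le_of_ne (hc0 g) (Finsupp.mem_support_iff.1 hg).symm
    refine hface.mem_of_smul_add_mem (y := ∑ i ∈ c.support.erase g, c i • i)
      (PointedCone.subset_hull hgs) ?_ hpos ?_
    · exact Submodule.sum_mem _ fun i hi => PointedCone.smul_mem _ (hc0 i)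
        (PointedCone.subset_hull (hcs (Finset.mem_of_mem_erase hi)))
    · rw [Finset.add_sum_erase _ (fun i => c i • i) hg]
      have := S.b_mem ρ
      rwa [← hc] at this
  refine ⟨g, hgs, le_antisymm ?_ (Submodule.span_le.2 (by simpa using hgρ))⟩
  have hg0 : g ≠ 0 := hs.ne_zero hgs
  intro x hx
  have hgspan : g ∈ Submodule.span ℝ (ρ.1 : Set (RealSpace N)) := Submodule.subset_span hgρ
  have hxspan : x ∈ Submodule.span ℝ (ρ.1 : Set (RealSpace N)) := Submodule.subset_span hx
  obtain ⟨r, hr⟩ := exists_smul_eq_of_finrank_eq_one ρ.2.2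
    (x := (⟨g, hgspan⟩ : Submodule.span ℝ (ρ.1 : Set (RealSpace N))))
    (by simpa [Subtype.ext_iff] using hg0) ⟨x, hxspan⟩
  have hrx : r • g = x := congrArg Subtype.val hr
  obtain ⟨c, hcs, hc0, hc⟩ := PointedCone.mem_hull_set.1 (hρ hx)
  have key : c = Finsupp.single g r := by
    have hinj := linearIndepOn_iff.1 hs (c - Finsupp.single g r) ?_ ?_
    · exact sub_eq_zero.1 hinj
    · exact Submodule.sub_mem _ hcs (Finsupp.single_mem_supported ℝ _ hgs)
    · simp only [map_sub, Finsupp.linearCombination_single, id]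
      rw [sub_eq_zero, hrx]
      exact hc
  have hr0 : 0 ≤ r := by
    have := hc0 g
    rwa [key, Finsupp.single_eq_same] at this
  rw [← hrx]
  exact PointedCone.smul_mem _ hr0 (PointedCone.subset_hull rfl)

/-- On a cone of the fan there is a rational linear form with value `1` at each `b_i` in it. -/
theorem exists_linearForm [Module.Free ℤ N] (S : StackyFan N) {σ : PointedCone ℝ (RealSpace N)}
    (hσ : σ ∈ S.cones) : ∃ l : RealSpace N →ₗ[ℝ] ℝ,
      (∀ n : N, ∃ q : ℚ, l (toReal n) = q) ∧
      ∀ ρ : S.Ray, ρ.1 ≤ σ → l (toReal (S.b ρ)) = 1 := by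
  classical
  obtain ⟨s, -, hs, rfl⟩ := S.simplicial σ hσ
  choose R k hR hk hb using fun g (hg : g ∈ s) => S.exists_ray hs hσ hg
  let B := Module.Basis.extend hs
  let l₀ : RealSpace N →ₗ[ℝ] ℝ := B.constr ℝ fun x => if h : x.1 ∈ s then (k x.1 h)⁻¹ else 0
  have hl₀ : ∀ ρ : S.Ray, ρ.1 ≤ PointedCone.hull ℝ s → l₀ (toReal (S.b ρ)) = 1 := by
    intro ρ hρ
    obtain ⟨g, hg, hρg⟩ := S.ray_eq hs hσ ρ hρ
    have hRg : ρ = R g hg := Subtype.ext (hρg.trans (hR g hg).symm)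
    have hgB : B ⟨g, hs.subset_extend _ hg⟩ = g := by simp [B]
    have hlg : l₀ g = (k g hg)⁻¹ := by
      conv_lhs => rw [← hgB]
      rw [B.constr_basis ℝ _ _, dif_pos hg]
    rw [hRg, hb g hg, map_smul, hlg, smul_eq_mul, mul_inv_cancel₀ (hk g hg).ne']
  obtain ⟨p, hp⟩ := LinearMap.exists_leftInverse_of_injective
    (Algebra.linearMap ℚ ℝ) (LinearMap.ker_eq_bot.2 (algebraMap ℚ ℝ).injective)
  have hp1 : p 1 = 1 := by simpa using LinearMap.congr_fun hp 1
  let m : N →ₗ[ℤ] ℝ := AddMonoidHom.toIntLinearMap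
    { toFun := fun n => ((p (l₀ (toReal n)) : ℚ) : ℝ)
      map_zero' := by simp [toReal]
      map_add' := fun x y => by simp [toReal, TensorProduct.tmul_add] }
  let l : RealSpace N →ₗ[ℝ] ℝ := TensorProduct.AlgebraTensorModule.lift
    (LinearMap.toSpanSingleton ℝ (N →ₗ[ℤ] ℝ) m)
  have hl : ∀ n : N, l (toReal n) = ((p (l₀ (toReal n)) : ℚ) : ℝ) := by
    intro n
    simp [l, toReal, m]
  refine ⟨l, fun n => ⟨_, hl n⟩, fun ρ hρ => ?_⟩
  rw [hl, hl₀ ρ hρ, hp1, Rat.cast_one]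

theorem exists_psi [Module.Free ℤ N] (S : StackyFan N) : ∃ f : RealSpace N → ℝ,
    S.IsPiecewiseQLinear f ∧ (∀ ρ, f (toReal (S.b ρ)) = 1) ∧ ∀ v ∉ S.support, f v = 0 := by
  classical
  choose! l hlq hl using fun σ (hσ : σ ∈ S.cones) => S.exists_linearForm hσ
  have agree : ∀ σ ∈ S.cones, ∀ τ ∈ S.cones, ∀ v, v ∈ σ → v ∈ τ → l σ v = l τ v := by
    intro σ hσ τ hτ v hvσ hvτ
    have hστ : σ ⊓ τ ∈ S.cones := S.face_mem _ hσ _ (S.inter_face _ hσ _ hτ).1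
    obtain ⟨s, -, hs, hse⟩ := S.simplicial _ hστ
    have hs' : PointedCone.hull ℝ s ∈ S.cones := hse ▸ hστ
    have hv : v ∈ PointedCone.hull ℝ s := hse ▸ ⟨hvσ, hvτ⟩
    have hsub : Set.EqOn (l σ) (l τ) s := by
      intro g hg
      obtain ⟨ρ, k, hρ, hk, hb⟩ := S.exists_ray hs hs' hg
      have hle : ρ.1 ≤ σ ⊓ τ := by
        rw [hρ, ← hse]
        exact Submodule.span_mono (by simpa using hg)
      have h1 := hl σ hσ ρ (hle.trans inf_le_left)
      have h2 := hl τ hτ ρ (hle.trans inf_le_right)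
      rw [hb, map_smul, smul_eq_mul] at h1 h2
      exact mul_left_cancel₀ hk.ne' (h1.trans h2.symm)
    exact LinearMap.eqOn_span hsub (PointedCone.hull_le_span ℝ s hv)
  let f : RealSpace N → ℝ := fun v =>
    if h : ∃ σ ∈ S.cones, v ∈ σ then l (Classical.choose h) v else 0
  have hf : ∀ σ ∈ S.cones, ∀ v ∈ σ, f v = l σ v := by
    intro σ hσ v hv
    have h : ∃ σ ∈ S.cones, v ∈ σ := ⟨σ, hσ, hv⟩
    simp only [f, dif_pos h]
    exact agree _ (Classical.choose_spec h).1 _ hσ v (Classical.choose_spec h).2 hv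
  refine ⟨f, fun σ hσ => ⟨l σ, hlq σ hσ, hf σ hσ⟩, fun ρ => ?_, fun v hv => ?_⟩
  · rw [hf ρ.1 ρ.2.1 _ (S.b_mem ρ)]
    exact hl _ ρ.2.1 ρ le_rfl
  · exact dif_neg hv

variable [Module.Free ℤ N]

/-- The function `ψ` that is `ℚ`-linear on each cone and satisfies `ψ(b_i) = 1` for every `i`,
extended by `0` outside of the support. -/
def psi (S : StackyFan N) : RealSpace N → ℝ := Classical.choose S.exists_psi

/-- `Q = {v ∈ |Σ| : ψ(v) ≤ 1}`. -/
def Q (S : StackyFan N) : Set (RealSpace N) := {v | v ∈ S.support ∧ S.psi v ≤ 1}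

/-- The weight function `w_λ(v) = ψ(v) - ⌈ψ(v)⌉ + λ(v)` on lattice points. -/
def weight (S : StackyFan N) (lam : RealSpace N → ℝ) (v : N) : ℝ :=
  S.psi (toReal v) - ⌈S.psi (toReal v)⌉ + lam (toReal v)

/-- `f_k^λ(m)`: the number of lattice points of weight `k` in `mQ`. -/
def weightCount (S : StackyFan N) (lam : RealSpace N → ℝ) (k : ℚ) (m : ℕ) : ℕ :=
  Set.ncard {v : N | toReal v ∈ (m : ℝ) • S.Q ∧ S.weight lam v = k}

/-- `δ_k^λ(t) = (1 - t)^(d + 1) ∑_{m ≥ 0} f_k^λ(m) t^m`, where `d` is the rank of `N`. -/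
def deltaPart (S : StackyFan N) (lam : RealSpace N → ℝ) (k : ℚ) : PowerSeries ℤ :=
  (1 - PowerSeries.X) ^ (Module.finrank ℤ N + 1) *
    PowerSeries.mk fun m => (S.weightCount lam k m : ℤ)

/-- The coefficient of `t^q` in the weighted `δ`-vector `δ^λ(t) = ∑_{k ∈ ℚ} δ_k^λ(t) t^k`:
the sum over `m` of the coefficient of `t^m` in `δ_{q - m}^λ(t)`. -/
def delta (S : StackyFan N) (lam : RealSpace N → ℝ) (q : ℚ) : ℤ :=
  ∑ᶠ m : ℕ, PowerSeries.coeff m (S.deltaPart lam (q - m))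

end StackyFan

/-- The formal series `∑_q c(q) t^q` with rational exponents lies in `ℤ[[t^(1/M)]]`, and as a
series in `x = t^(1/M)` it is the expansion at `x = 0` of the rational function `R(x)`. -/
def IsExpansion (c : ℚ → ℤ) (M : ℕ) (R : RatFunc ℚ) : Prop :=
  0 < M ∧ (∀ q, c q ≠ 0 → ∃ n : ℕ, q = n / M) ∧
    ∀ n : ℤ, (R : ℚ⸨X⸩).coeff n = c (n / M)

end WeightedEhrhart

end

/-! The heart of the matter is the identity δ^λ(t) = (1-t)^d F(t), where F(t) is the sum of
t^((ψ+λ)(v)) over all lattice points v. Indeed v lies in mQ exactly when ⌈ψ(v)⌉ ≤ m, so summing over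
m produces t^⌈ψ(v)⌉/(1-t), and the factor t^(w_λ(v)) replaces ⌈ψ(v)⌉ by ψ(v)+λ(v) (`deltaPart_eq`,
`weight_eq_iff`, `delta_eq_sum`). The hypothesis λ(b_i) > -1 makes ψ+λ positive on every b_i, so its
level sets in N are finite and F makes sense.

It remains to see that F(1/t) = (-1)^d F(t). For a generic vector ξ, assign v to the
full-dimensional cone whose interior contains v + sξ for all small s > 0; this partitions N into
half-open simplicial cones (`existsUnique_fullCone_halfOpen`). The series of one such cone is a sum
over a half-open parallelepiped divided by ∏(1 - x^(deg b_i)). The reflection v ↦ ∑ b_i - v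
exchanges open and closed facets, so x ↦ 1/x yields (-1)^d times the function of the opposite
half-open cone (`substHom_inv_coneFun`). The opposite half-open cones are those of -ξ and partition
N as well, so both sums equal F (`exists_ratFunc_genSeries_univ`).

An arbitrary M is handled by passing to t^(1/(KM)), with K a common denominator of ψ+λ on N
(`IsExpansion.functional_equation`). -/

noncomputable section

namespace WeightedEhrhart

/-! ### Substitutions in rational functions -/

section Substitution

variable {K : Type*} [Field K]

/-- Substitution of a transcendental element for the variable of a rational function. -/
def substHom (a : RatFunc K) (ha : Transcendental K a) : RatFunc K →+* RatFunc K :=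
  RatFunc.liftRingHom (Polynomial.aeval a).toRingHom
    (nonZeroDivisors_le_comap_nonZeroDivisors_of_injective _
      (transcendental_iff_injective.1 ha))

theorem substHom_algebraMap (a : RatFunc K) (ha : Transcendental K a) (p : Polynomial K) :
    substHom a ha (algebraMap _ _ p) = Polynomial.aeval a p := by
  simp [substHom]

theorem substHom_X (a : RatFunc K) (ha : Transcendental K a) :
    substHom a ha RatFunc.X = a := by
  rw [← RatFunc.algebraMap_X, substHom_algebraMap, Polynomial.aeval_X]

/-- `RatFunc.eval` is multiplicative only where denominators do not vanish; transcendence of `a`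
guarantees this, so evaluation at X⁻¹ can be handled as a ring homomorphism. -/
theorem eval_eq_substHom (a : RatFunc K) (ha : Transcendental K a) (R : RatFunc K) :
    R.eval RatFunc.C a = substHom a ha R := by
  rw [substHom, RatFunc.liftRingHom_apply]
  simp [RatFunc.eval, Polynomial.aeval_def]

theorem transcendental_X_inv : Transcendental K (RatFunc.X⁻¹ : RatFunc K) := by
  intro h
  exact RatFunc.transcendental_X (K := K) (by simpa using h.inv)

theorem transcendental_X_pow {M : ℕ} (hM : 0 < M) :
    Transcendental K (RatFunc.X ^ M : RatFunc K) :=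
  RatFunc.transcendental_X.pow hM

theorem substHom_C (a : RatFunc K) (ha : Transcendental K a) (r : K) :
    substHom a ha (RatFunc.C r) = RatFunc.C r := by
  rw [← RatFunc.algebraMap_C, substHom_algebraMap, Polynomial.aeval_C]
  simp

/-- Two ring homomorphisms on rational functions that agree on constants and on the variable are
equal. -/
theorem ratFunc_ringHom_ext {L : Type*} [Field L] (f g : RatFunc K →+* L)
    (hC : f.comp RatFunc.C = g.comp RatFunc.C) (h : f RatFunc.X = g RatFunc.X) : f = g := by
  apply IsLocalization.ringHom_ext (nonZeroDivisors (Polynomial K))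
  apply Polynomial.ringHom_ext
  · intro r
    simpa using DFunLike.congr_fun hC r
  · simpa using h

/-- Both composites fix constants, so they need only be compared on the variable. It is applied to
X^K and X⁻¹. -/
theorem substHom_comm (a b : RatFunc K) (ha : Transcendental K a) (hb : Transcendental K b)
    (h : substHom a ha b = substHom b hb a) (R : RatFunc K) :
    substHom a ha (substHom b hb R) = substHom b hb (substHom a ha R) := by
  have := ratFunc_ringHom_ext ((substHom a ha).comp (substHom b hb))
    ((substHom b hb).comp (substHom a ha)) (by ext; simp [substHom_C])
    (by simpa [substHom_X] using h)
  exact DFunLike.congr_fun this R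

/-! ### Refining the root t^(1/M) -/

/-- Stretching the exponents of a Laurent series by a positive integer. -/
def stretch (M : ℕ) (hM : 0 < M) : ℚ⸨X⸩ →+* ℚ⸨X⸩ :=
  HahnSeries.embDomainRingHom (AddMonoidHom.mulLeft (M : ℤ))
    (fun a b h => by
      have : (M : ℤ) ≠ 0 := by exact_mod_cast hM.ne'
      exact mul_left_cancel₀ this h)
    (fun a b => by
      have : (0 : ℤ) < M := by exact_mod_cast hM
      exact mul_le_mul_iff_of_pos_left this)

theorem stretch_coeff_mul (M : ℕ) (hM : 0 < M) (f : ℚ⸨X⸩) (n : ℤ) :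
    (stretch M hM f).coeff (M * n) = f.coeff n :=
  HahnSeries.embDomain_coeff (a := n)

theorem stretch_coeff_of_not_dvd (M : ℕ) (hM : 0 < M) (f : ℚ⸨X⸩) (n : ℤ) (h : ¬ (M : ℤ) ∣ n) :
    (stretch M hM f).coeff n = 0 :=
  HahnSeries.embDomain_of_notMem_range (by
    rintro ⟨k, hk⟩
    exact h ⟨k, hk.symm⟩)

theorem stretch_single_one (M : ℕ) (hM : 0 < M) :
    stretch M hM (HahnSeries.single 1 1) = HahnSeries.single (M : ℤ) 1 := by
  have hM' : (M : ℤ) ≠ 0 := by exact_mod_cast hM.ne'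
  ext n
  by_cases hn : (M : ℤ) ∣ n
  · obtain ⟨k, rfl⟩ := hn
    rw [stretch_coeff_mul]
    simp [HahnSeries.coeff_single, mul_eq_left₀ hM']
  · rw [stretch_coeff_of_not_dvd _ _ _ _ hn, HahnSeries.coeff_single_of_ne]
    rintro rfl
    exact hn dvd_rfl

open scoped RatFunc in
theorem coe_substHom_X_pow (M : ℕ) (hM : 0 < M) (R : RatFunc ℚ) :
    ((substHom _ (transcendental_X_pow hM) R : RatFunc ℚ) : ℚ⸨X⸩) = stretch M hM R := by
  have := ratFunc_ringHom_ext
    ((algebraMap (RatFunc ℚ) ℚ⸨X⸩).comp (substHom _ (transcendental_X_pow hM)))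
    -- Agreement on constants is automatic: ring homomorphisms out of ℚ are unique.
    ((stretch M hM).comp (algebraMap (RatFunc ℚ) ℚ⸨X⸩)) (Subsingleton.elim _ _) (by
      simp only [RingHom.comp_apply, substHom_X, map_pow]
      rw [RatFunc.coe_X, stretch_single_one, RatFunc.single_one_eq_pow])
  exact DFunLike.congr_fun this R

open scoped RatFunc in
theorem coe_ratFunc_injective : Function.Injective (fun R : RatFunc ℚ => (R : ℚ⸨X⸩)) :=
  (algebraMap (RatFunc ℚ) ℚ⸨X⸩).injective

/-- An expansion in `t^(1/M)` gives one in `t^(1/(KM))`. -/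
theorem IsExpansion.subst_X_pow {c : ℚ → ℤ} {M : ℕ} {R : RatFunc ℚ} (h : IsExpansion c M R)
    {K : ℕ} (hK : 0 < K) :
    IsExpansion c (K * M) (substHom _ (transcendental_X_pow hK) R) := by
  obtain ⟨hM, hc, hR⟩ := h
  have hM' : (M : ℚ) ≠ 0 := by exact_mod_cast hM.ne'
  have hK' : (K : ℚ) ≠ 0 := by exact_mod_cast hK.ne'
  refine ⟨Nat.mul_pos hK hM, fun q hq => ?_, fun n => ?_⟩
  · obtain ⟨n, hn⟩ := hc q hq
    refine ⟨K * n, ?_⟩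
    rw [hn]
    push_cast
    field_simp
  · rw [coe_substHom_X_pow K hK]
    by_cases hn : (K : ℤ) ∣ n
    · obtain ⟨k, rfl⟩ := hn
      rw [stretch_coeff_mul, hR]
      congr 2
      push_cast
      field_simp
    · rw [stretch_coeff_of_not_dvd _ _ _ _ hn]
      -- The support of `c` lies in (1/M)ℕ, so a nonzero value at n/(KM) would force K ∣ n.
      by_contra h0
      have h1 : c ((n : ℚ) / ((K * M : ℕ) : ℚ)) ≠ 0 := by
        intro h2
        rw [h2] at h0
        simp at h0
      obtain ⟨k, hk⟩ := hc _ h1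
      apply hn
      refine ⟨k, ?_⟩
      push_cast at hk
      field_simp at hk
      exact_mod_cast hk

theorem IsExpansion.unique {c : ℚ → ℤ} {M : ℕ} {R R' : RatFunc ℚ} (h : IsExpansion c M R)
    (h' : IsExpansion c M R') : R = R' := by
  apply coe_ratFunc_injective
  ext n
  exact (h.2.2 n).trans (h'.2.2 n).symm

/-- If the functional equation holds for one expansion in `t^(1/(KM))` it holds for every
expansion in `t^(1/M)`. -/
theorem IsExpansion.functional_equation {c : ℚ → ℤ} {M K d : ℕ} {R R' : RatFunc ℚ}
    (h : IsExpansion c M R) (hK : 0 < K) (h' : IsExpansion c (K * M) R')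
    (hR' : R' = RatFunc.X ^ (K * M * d) * substHom _ transcendental_X_inv R') :
    R = RatFunc.X ^ (M * d) * R.eval RatFunc.C RatFunc.X⁻¹ := by
  rw [eval_eq_substHom _ transcendental_X_inv]
  -- Substituting X^K is injective and turns `R` into `R'` by uniqueness of expansions, so the
  -- identity can be checked in the finer variable.
  apply (substHom (RatFunc.X ^ K : RatFunc ℚ) (transcendental_X_pow hK)).injective
  have hR := (h.subst_X_pow hK).unique h'
  rw [map_mul, map_pow, substHom_X, ← pow_mul, ← mul_assoc,
    substHom_comm (RatFunc.X ^ K) RatFunc.X⁻¹ (transcendental_X_pow hK) transcendental_X_inv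
      (by simp [substHom_X]), hR]
  exact hR'

end Substitution

/-! ### Generating functions of half-open simplicial cones -/

section Generating

variable {A : Type*} {deg : A → ℕ}

/-- The generating function of a set with respect to a degree function. -/
def genSeries (deg : A → ℕ) (s : Set A) : PowerSeries ℚ :=
  PowerSeries.mk fun n => (Set.ncard {v | v ∈ s ∧ deg v = n} : ℚ)

theorem genSeries_union (hfin : ∀ n, {v | deg v = n}.Finite) {s t : Set A} (h : Disjoint s t) :
    genSeries deg (s ∪ t) = genSeries deg s + genSeries deg t := by
  ext n
  simp only [genSeries, PowerSeries.coeff_mk, map_add]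
  rw [← Nat.cast_add, ← Set.ncard_union_eq (h.mono (fun v hv => hv.1) (fun v hv => hv.1))
    ((hfin n).subset fun v hv => hv.2) ((hfin n).subset fun v hv => hv.2)]
  congr 2
  ext v
  exact or_and_right

theorem genSeries_translate [AddGroup A] {s : Set A} {g : A}
    (h : ∀ v ∈ s, deg (v + g) = deg v + deg g) :
    genSeries deg ((· + g) '' s) = genSeries deg s * PowerSeries.X ^ deg g := by
  ext n
  rw [PowerSeries.coeff_mul_X_pow']
  simp only [genSeries, PowerSeries.coeff_mk]
  split_ifs with hn
  · rw [← Set.ncard_image_of_injective {v | v ∈ s ∧ deg v = n - deg g} (add_left_injective g)]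
    congr 2
    ext v
    constructor
    · rintro ⟨⟨u, hu, rfl⟩, hd⟩
      have := h u hu
      exact ⟨u, ⟨hu, by simp only at hd; omega⟩, rfl⟩
    · rintro ⟨u, ⟨hu, hd⟩, rfl⟩
      have := h u hu
      exact ⟨⟨u, hu, rfl⟩, by simp only; omega⟩
  · rw [Nat.cast_eq_zero, Set.ncard_eq_zero (Set.Finite.subset Set.finite_empty ?_)]
    all_goals
      try rw [Set.eq_empty_iff_forall_notMem]
      rintro v ⟨⟨u, hu, rfl⟩, hd⟩
      have := h u hu
      simp only at hd
      omega

theorem genSeries_univ_eq_sum {κ : Type*} [Fintype κ] (hfin : ∀ n, {v | deg v = n}.Finite)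
    (s : κ → Set A) (hs : ∀ v, ∃! k, v ∈ s k) :
    genSeries deg Set.univ = ∑ k, genSeries deg (s k) := by
  classical
  choose f hf hf' using hs
  ext n
  simp only [genSeries, map_sum, PowerSeries.coeff_mk, Set.mem_univ, true_and]
  rw [Set.ncard_eq_toFinset_card _ (hfin n),
    Finset.card_eq_sum_card_fiberwise (f := f) (t := Finset.univ) (fun _ _ => Finset.mem_univ _),
    Nat.cast_sum]
  refine Finset.sum_congr rfl fun k _ => ?_
  rw [← Set.ncard_coe_finset]
  congr 2
  ext v
  simp only [Finset.coe_filter, Set.Finite.mem_toFinset, Set.mem_ofPred_eq]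
  constructor
  · rintro ⟨h1, rfl⟩
    exact ⟨hf v, h1⟩
  · rintro ⟨h1, h2⟩
    exact ⟨h2, (hf' v k h1).symm⟩

end Generating

/-- A full-dimensional simplicial cone with marked lattice points on its rays, together with a
degree function that is linear on the cone and positive on the marked points. -/
structure Chamber (A : Type*) [AddCommGroup A] (deg : A → ℕ) (ι : Type*) [Fintype ι]
    [DecidableEq ι] where
  coord : A →+ (ι → ℝ)
  gen : ι → A
  coord_gen : ∀ i, coord (gen i) = Pi.single i 1
  deg_eq : ∀ v, (∀ j, 0 ≤ coord v j) → (deg v : ℝ) = ∑ i, coord v i * deg (gen i)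
  deg_pos : ∀ i, 0 < deg (gen i)
  finite_box : {v | ∀ i, 0 ≤ coord v i ∧ coord v i ≤ 1}.Finite

/-! ### Parallelepiped decomposition and reciprocity for one half-open cone -/

namespace Chamber

variable {A : Type*} [AddCommGroup A] {deg : A → ℕ} {ι : Type*} [Fintype ι] [DecidableEq ι]
  (c : Chamber A deg ι) (ε : Set ι)

/-- The points of the half-open cone, open along the facets indexed by the complement of `ε`,
whose coordinates in `I` lie in the half-open unit interval. -/
def partialBox (I : Finset ι) : Set A :=
  {v | ∀ i, (0 < c.coord v i ∨ i ∈ ε ∧ c.coord v i = 0) ∧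
    (i ∈ I → c.coord v i < 1 ∨ i ∉ ε ∧ c.coord v i = 1)}

/-- The lattice points of the half-open cone. -/
def halfOpen : Set A := {v | ∀ i, 0 < c.coord v i ∨ i ∈ ε ∧ c.coord v i = 0}

theorem partialBox_empty : c.partialBox ε ∅ = c.halfOpen ε := by
  simp [partialBox, halfOpen]

theorem coord_nonneg {I : Finset ι} {v : A} (hv : v ∈ c.partialBox ε I) (i : ι) :
    0 ≤ c.coord v i := by
  rcases (hv i).1 with h | h
  · exact h.le
  · exact h.2.ge

theorem deg_add_gen {v : A} (hv : ∀ j, 0 ≤ c.coord v j) (i : ι) :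
    deg (v + c.gen i) = deg v + deg (c.gen i) := by
  have h : (deg (v + c.gen i) : ℝ) = deg v + deg (c.gen i) := by
    rw [c.deg_eq _ hv, c.deg_eq (v + c.gen i)]
    · simp [c.coord_gen, add_mul, Finset.sum_add_distrib, Pi.single_apply]
    · intro j
      rw [map_add, c.coord_gen, Pi.add_apply]
      refine add_nonneg (hv j) ?_
      by_cases h : j = i
      · subst h; simp
      · simp [h]
  exact_mod_cast h

/-- A half-line starting at 0 is its unit interval together with its own translate by 1. The
interval is closed at 1 exactly when it is open at 0, so nothing is lost or counted twice. -/
theorem partialBox_eq_union {I : Finset ι} {i : ι} (hi : i ∉ I) :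
    c.partialBox ε I = c.partialBox ε (insert i I) ∪ (· + c.gen i) '' c.partialBox ε I := by
  ext v
  constructor
  · intro hv
    by_cases hb : c.coord v i < 1 ∨ i ∉ ε ∧ c.coord v i = 1
    · left
      intro j
      refine ⟨(hv j).1, fun hj => ?_⟩
      rcases Finset.mem_insert.1 hj with rfl | hj
      · exact hb
      · exact (hv j).2 hj
    · right
      refine ⟨v - c.gen i, fun j => ?_, by simp⟩
      rw [map_sub, c.coord_gen, Pi.sub_apply]
      by_cases hj : j = i
      · subst hj
        refine ⟨?_, fun h => absurd h hi⟩
        push Not at hb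
        rw [Pi.single_eq_same]
        rcases hb.1.lt_or_eq with h | h
        · left; linarith
        · right
          refine ⟨?_, by linarith⟩
          by_contra hε
          exact hb.2 hε h.symm
      · simpa [hj] using hv j
  · rintro (hv | ⟨u, hu, rfl⟩)
    · exact fun j => ⟨(hv j).1, fun hj => (hv j).2 (Finset.mem_insert_of_mem hj)⟩
    · intro j
      simp only [map_add, c.coord_gen, Pi.add_apply]
      by_cases hj : j = i
      · subst hj
        refine ⟨Or.inl ?_, fun h => absurd h hi⟩
        have := c.coord_nonneg ε hu j
        rw [Pi.single_eq_same]
        linarith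
      · simpa [hj] using hu j

theorem disjoint_partialBox {I : Finset ι} {i : ι} :
    Disjoint (c.partialBox ε (insert i I)) ((· + c.gen i) '' c.partialBox ε I) := by
  rw [Set.disjoint_left]
  rintro _ hv ⟨u, hu, rfl⟩
  have h1 := (hv i).2 (Finset.mem_insert_self _ _)
  have h2 := c.coord_nonneg ε hu i
  simp only [map_add, c.coord_gen, Pi.add_apply, Pi.single_eq_same] at h1
  rcases h1 with h1 | ⟨h1, h3⟩
  · linarith
  · rcases (hu i).1 with h | h
    · linarith
    · exact h1 h.1

/-- The decomposition along coordinate i reads G_I = G_(I ∪ {i}) + X^(deg b_i) G_I, so each new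
index contributes one factor 1 - X^(deg b_i). -/
theorem genSeries_partialBox (hfin : ∀ n, {v | deg v = n}.Finite) (I : Finset ι) :
    genSeries deg (c.partialBox ε I) =
      genSeries deg (c.halfOpen ε) * ∏ i ∈ I, (1 - PowerSeries.X ^ deg (c.gen i)) := by
  induction I using Finset.induction_on with
  | empty => simp [partialBox_empty]
  | insert i I hi ih =>
    have h1 := congrArg (genSeries deg) (c.partialBox_eq_union ε hi)
    rw [genSeries_union hfin (c.disjoint_partialBox ε),
      genSeries_translate fun v hv => c.deg_add_gen (c.coord_nonneg ε hv) i] at h1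
    rw [Finset.prod_insert hi, mul_left_comm, ← ih]
    linear_combination -h1

theorem finite_partialBox : (c.partialBox ε Finset.univ).Finite := by
  refine c.finite_box.subset fun v hv i => ⟨c.coord_nonneg ε hv i, ?_⟩
  rcases (hv i).2 (Finset.mem_univ i) with h | h
  · exact h.le
  · exact h.2.le

/-- The lattice points of the half-open fundamental parallelepiped. -/
def box : Finset A := (c.finite_partialBox ε).toFinset

theorem mem_box {v : A} : v ∈ c.box ε ↔ v ∈ c.partialBox ε Finset.univ := by simp [box]

/-- The numerator of the generating function of the half-open cone. -/
def numerator : Polynomial ℚ := ∑ v ∈ c.box ε, Polynomial.X ^ deg v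

/-- The denominator of the generating function of the half-open cone. -/
def denominator : Polynomial ℚ := ∏ i, (1 - Polynomial.X ^ deg (c.gen i))

/-- The generating function of the half-open cone, as a rational function. -/
def coneFun : RatFunc ℚ := algebraMap _ _ (c.numerator ε) / algebraMap _ _ c.denominator

theorem coe_numerator : (c.numerator ε : PowerSeries ℚ) =
    genSeries deg (c.partialBox ε Finset.univ) := by
  classical
  ext n
  rw [Polynomial.coeff_coe, numerator, Polynomial.finsetSum_coeff]
  simp only [Polynomial.coeff_X_pow, genSeries, PowerSeries.coeff_mk, Finset.sum_boole]
  rw [← Set.ncard_coe_finset]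
  congr 2
  ext v
  simp [mem_box, eq_comm]

theorem denominator_ne_zero : c.denominator ≠ 0 := by
  rw [denominator, Finset.prod_ne_zero_iff]
  intro i _ h
  have := congrArg (Polynomial.eval 0) h
  simp [(c.deg_pos i).ne'] at this

open scoped RatFunc in
theorem coe_coneFun (hfin : ∀ n, {v | deg v = n}.Finite) :
    ((c.coneFun ε : RatFunc ℚ) : ℚ⸨X⸩) = (genSeries deg (c.halfOpen ε) : ℚ⸨X⸩) := by
  have hD : algebraMap (Polynomial ℚ) (RatFunc ℚ) c.denominator ≠ 0 := by
    simpa using c.denominator_ne_zero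
  have hD' : algebraMap (RatFunc ℚ) ℚ⸨X⸩ (algebraMap (Polynomial ℚ) (RatFunc ℚ) c.denominator) ≠ 0 := by
    simpa using c.denominator_ne_zero
  rw [coneFun, map_div₀, div_eq_iff hD']
  have h1 := c.genSeries_partialBox ε hfin Finset.univ
  rw [← c.coe_numerator] at h1
  have h2 : ∏ i, (1 - PowerSeries.X ^ deg (c.gen i)) = (c.denominator : PowerSeries ℚ) := by
    rw [denominator, ← Polynomial.coeToPowerSeries.ringHom_apply, map_prod]
    simp
  rw [h2] at h1
  have h3 := congrArg (HahnSeries.ofPowerSeries ℤ ℚ) h1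
  rw [map_mul, RatFunc.coe_coe, RatFunc.coe_coe] at h3
  exact h3

/-- The symmetry of the fundamental parallelepiped. -/
theorem reflect_mem_box {v : A} (hv : v ∈ c.box ε) : ∑ i, c.gen i - v ∈ c.box εᶜ := by
  rw [mem_box] at hv ⊢
  intro i
  have h : c.coord (∑ i, c.gen i - v) i = 1 - c.coord v i := by
    simp [c.coord_gen, Pi.single_apply]
  rw [h]
  obtain ⟨h1, h2⟩ := hv i
  -- The map x ↦ 1 - x exchanges [0,1) and (0,1], which is why `ε` turns into its complement.
  refine ⟨?_, fun _ => ?_⟩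
  · rcases h2 (Finset.mem_univ i) with h | h
    · left; linarith
    · exact Or.inr ⟨h.1, by linarith [h.2]⟩
  · rcases h1 with h | h
    · left; linarith
    · exact Or.inr ⟨by simpa using h.1, by linarith [h.2]⟩

/-- Both points lie in the closed cone, where the degree is linear, and their coordinates add up to
1. -/
theorem deg_add_deg_reflect {v : A} (hv : v ∈ c.box ε) :
    deg v + deg (∑ i, c.gen i - v) = ∑ i, deg (c.gen i) := by
  have h1 := c.deg_eq v fun j => c.coord_nonneg ε ((c.mem_box ε).1 hv) j
  have h2 := c.deg_eq _ fun j => c.coord_nonneg εᶜ ((c.mem_box _).1 (c.reflect_mem_box ε hv)) j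
  have h : ((deg v + deg (∑ i, c.gen i - v) : ℕ) : ℝ) = ((∑ i, deg (c.gen i) : ℕ) : ℝ) := by
    push_cast
    rw [h1, h2, ← Finset.sum_add_distrib]
    refine Finset.sum_congr rfl fun i _ => ?_
    simp [c.coord_gen, Pi.single_apply]
    ring
  exact_mod_cast h

theorem substHom_inv_numerator :
    substHom _ transcendental_X_inv (algebraMap _ (RatFunc ℚ) (c.numerator ε)) *
      RatFunc.X ^ (∑ i, deg (c.gen i)) = algebraMap (Polynomial ℚ) _ (c.numerator εᶜ) := by
  simp only [numerator, map_sum, map_pow, RatFunc.algebraMap_X, substHom_X, Finset.sum_mul]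
  refine Finset.sum_nbij' (fun v => ∑ i, c.gen i - v) (fun v => ∑ i, c.gen i - v)
    (fun v hv => c.reflect_mem_box ε hv)
    (fun v hv => by simpa using c.reflect_mem_box εᶜ hv) (by simp) (by simp) fun v hv => ?_
  rw [← c.deg_add_deg_reflect ε hv, pow_add, ← mul_assoc, ← mul_pow,
    inv_mul_cancel₀ RatFunc.X_ne_zero, one_pow, one_mul]

/-- Each factor satisfies (1 - X^(-a)) X^a = -(1 - X^a); these signs are the source of (-1)^d. -/
theorem substHom_inv_denominator :
    substHom _ transcendental_X_inv (algebraMap _ _ c.denominator) *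
      RatFunc.X ^ (∑ i, deg (c.gen i)) =
      (-1) ^ Fintype.card ι * algebraMap (Polynomial ℚ) (RatFunc ℚ) c.denominator := by
  rw [← Finset.prod_pow_eq_pow_sum, ← Finset.card_univ, ← Finset.prod_const]
  simp only [denominator, map_prod, map_sub, map_one, map_pow, RatFunc.algebraMap_X, substHom_X]
  rw [← Finset.prod_mul_distrib, ← Finset.prod_mul_distrib]
  refine Finset.prod_congr rfl fun i _ => ?_
  rw [sub_mul, ← mul_pow, inv_mul_cancel₀ RatFunc.X_ne_zero, one_pow]
  ring

/-- Stanley reciprocity for half-open simplicial cones. -/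
theorem substHom_inv_coneFun :
    substHom _ transcendental_X_inv (c.coneFun ε) = (-1) ^ Fintype.card ι * c.coneFun εᶜ := by
  have hD : algebraMap (Polynomial ℚ) (RatFunc ℚ) c.denominator ≠ 0 := by
    simpa using c.denominator_ne_zero
  have hX : (RatFunc.X : RatFunc ℚ) ^ (∑ i, deg (c.gen i)) ≠ 0 :=
    pow_ne_zero _ RatFunc.X_ne_zero
  have hs : ((-1 : RatFunc ℚ) ^ Fintype.card ι) ≠ 0 := pow_ne_zero _ (by simp)
  rw [coneFun, map_div₀, ← mul_div_mul_right _ _ hX, substHom_inv_numerator,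
    substHom_inv_denominator, coneFun, div_eq_iff (mul_ne_zero hs hD)]
  have h2 : ((-1 : RatFunc ℚ) ^ Fintype.card ι) * (-1) ^ Fintype.card ι = 1 := by
    rw [← mul_pow]; simp
  rw [mul_mul_mul_comm, h2, one_mul, div_mul_cancel₀ _ hD]

end Chamber

/-! ### From single cones to the whole lattice -/

open scoped RatFunc in
/-- If the half-open cones of a family of chambers partition the lattice for two opposite choices
of the facets to remove, then the generating function of the lattice is a rational function that
is symmetric up to sign. -/
theorem exists_ratFunc_genSeries_univ {A : Type*} [AddCommGroup A] {deg : A → ℕ} {ι κ : Type*}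
    [Fintype ι] [DecidableEq ι] [Fintype κ] (hfin : ∀ n, {v | deg v = n}.Finite)
    (c : κ → Chamber A deg ι) (ε : κ → Set ι)
    (h : ∀ v, ∃! k, v ∈ (c k).halfOpen (ε k)) (h' : ∀ v, ∃! k, v ∈ (c k).halfOpen (ε k)ᶜ) :
    ∃ R : RatFunc ℚ, (R : ℚ⸨X⸩) = (genSeries deg (Set.univ : Set A) : ℚ⸨X⸩) ∧
      substHom _ transcendental_X_inv R = (-1) ^ Fintype.card ι * R := by
  have hε : ∀ ε : κ → Set ι, (∀ v, ∃! k, v ∈ (c k).halfOpen (ε k)) →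
      ((∑ k, (c k).coneFun (ε k) : RatFunc ℚ) : ℚ⸨X⸩) =
        (genSeries deg (Set.univ : Set A) : ℚ⸨X⸩) := by
    intro ε h
    rw [genSeries_univ_eq_sum hfin _ h, map_sum, map_sum]
    exact Finset.sum_congr rfl fun k _ => (c k).coe_coneFun _ hfin
  refine ⟨∑ k, (c k).coneFun (ε k), hε ε h, ?_⟩
  -- Both partitions compute the series of the whole lattice, and a rational function is determined
  -- by its expansion.
  have heq : ∑ k, (c k).coneFun (ε k) = ∑ k, (c k).coneFun (ε k)ᶜ :=
    coe_ratFunc_injective ((hε ε h).trans (hε (fun k => (ε k)ᶜ) h').symm)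
  conv_rhs => rw [heq]
  rw [map_sum, Finset.mul_sum]
  exact Finset.sum_congr rfl fun k _ => (c k).substHom_inv_coneFun _

/-! ### Full-dimensional cones of a complete simplicial fan -/

theorem mem_hull_range_basis {E ι : Type*} [AddCommGroup E] [Module ℝ E] [Fintype ι]
    (B : Module.Basis ι ℝ E) (v : E) :
    v ∈ PointedCone.hull ℝ (Set.range B) ↔ ∀ i, 0 ≤ B.repr v i := by
  constructor
  · intro hv i
    induction hv using Submodule.span_induction with
    | mem x hx =>
      obtain ⟨j, rfl⟩ := hx
      classical
      rw [B.repr_self, Finsupp.single_apply]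
      split_ifs <;> simp
    | zero => simp
    | add x y _ _ hx hy => simpa using add_nonneg hx hy
    | smul a x _ hx =>
      have : a • x = (a : ℝ) • x := rfl
      rw [this, map_smul, Finsupp.smul_apply, smul_eq_mul]
      exact mul_nonneg a.2 hx
  · intro h
    rw [← B.sum_repr v]
    exact Submodule.sum_mem _ fun i _ =>
      PointedCone.smul_mem _ (h i) (PointedCone.subset_hull ⟨i, rfl⟩)

theorem toReal_add {N : Type*} [AddCommGroup N] (x y : N) :
    toReal (x + y) = toReal x + toReal y := TensorProduct.tmul_add _ _ _

theorem toReal_zero {N : Type*} [AddCommGroup N] : toReal (0 : N) = 0 :=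
  TensorProduct.tmul_zero _ _

/-- A bounded region contains only finitely many lattice points. -/
theorem finite_lattice_box {N ι : Type*} [AddCommGroup N] [Module.Free ℤ N] [Module.Finite ℤ N]
    [Fintype ι] (B : Module.Basis ι ℝ (RealSpace N)) (C : ι → ℝ) :
    {v : N | ∀ i, 0 ≤ B.repr (toReal v) i ∧ B.repr (toReal v) i ≤ C i}.Finite := by
  classical
  let e := Module.Free.chooseBasis ℤ N
  let e' := Algebra.TensorProduct.basis ℝ e
  have he : ∀ v j, e'.repr (toReal v) j = (e.repr v j : ℝ) := by
    intro v j
    simp [e', toReal, Algebra.TensorProduct.basis_repr_tmul]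
  let D : Module.Free.ChooseBasisIndex ℤ N → ℤ :=
    fun j => ⌈∑ i, C i * |e'.repr (B i) j|⌉
  have hfin : (Set.univ.pi fun j => Set.Icc (-D j) (D j)).Finite :=
    Set.Finite.pi fun j => Set.finite_Icc _ _
  refine (hfin.preimage (f := fun v : N => ⇑(e.repr v)) ?_).subset ?_
  · exact (DFunLike.coe_injective.comp e.repr.injective).injOn
  · intro v hv j _
    rw [Set.mem_Icc, ← abs_le]
    have h1 : (e.repr v j : ℝ) = ∑ i, B.repr (toReal v) i * e'.repr (B i) j := by
      have h := congrArg (e'.coord j) (B.sum_repr (toReal v))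
      simp only [map_sum, map_smul, smul_eq_mul, Module.Basis.coord_apply] at h
      rw [← he, h]
    have h2 : |(e.repr v j : ℝ)| ≤ ∑ i, C i * |e'.repr (B i) j| := by
      rw [h1]
      refine (Finset.abs_sum_le_sum_abs _ _).trans (Finset.sum_le_sum fun i _ => ?_)
      rw [abs_mul, abs_of_nonneg (hv i).1]
      exact mul_le_mul_of_nonneg_right (hv i).2 (abs_nonneg _)
    have h3 := h2.trans (Int.le_ceil _)
    exact_mod_cast h3

namespace StackyFan

variable {N : Type*} [AddCommGroup N] [Module.Free ℤ N]

/-- The full-dimensional cones of the fan. -/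
def FullCone (S : StackyFan N) : Type _ :=
  {σ : PointedCone ℝ (RealSpace N) //
    σ ∈ S.cones ∧ Submodule.span ℝ (σ : Set (RealSpace N)) = ⊤}

instance (S : StackyFan N) : Finite S.FullCone :=
  (S.finite_cones.subset fun _ h => h.1 :
    {σ | σ ∈ S.cones ∧ Submodule.span ℝ (σ : Set (RealSpace N)) = ⊤}.Finite)

/-- The independent generators of a full-dimensional cone form a basis, and each is a positive
multiple of some b_i away from it; rescaling keeps the signs of coordinates. -/
theorem exists_basis_of_fullCone (S : StackyFan N) (σ : S.FullCone) :
    ∃ (B : Module.Basis (Fin (Module.finrank ℤ N)) ℝ (RealSpace N))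
      (ρ : Fin (Module.finrank ℤ N) → S.Ray),
      (∀ i, B i = toReal (S.b (ρ i))) ∧ ∀ v, v ∈ σ.1 ↔ ∀ i, 0 ≤ B.repr v i := by
  obtain ⟨σ, hσ, hspan⟩ := σ
  obtain ⟨s, hsf, hs, rfl⟩ := S.simplicial σ hσ
  choose R k hR hk hb using fun g : s => S.exists_ray hs hσ g.2
  have htop : ⊤ ≤ Submodule.span ℝ (Set.range fun x : s => id (x : RealSpace N)) := by
    rw [← hspan]
    refine Submodule.span_le.2 ?_
    simp
  let B₀ : Module.Basis s ℝ (RealSpace N) := Module.Basis.mk hs htop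
  have hB₀ : ∀ g : s, B₀ g = g := fun g => by simp [B₀]
  let B₁ := B₀.unitsSMul fun g => Units.mk0 (k g) (hk g).ne'
  have : Fintype s := hsf.fintype
  have hcard : Fintype.card s = Module.finrank ℤ N := by
    rw [← Module.finrank_eq_card_basis B₀]
    exact Module.finrank_baseChange
  let e := Fintype.equivFinOfCardEq hcard
  refine ⟨B₁.reindex e, fun i => R (e.symm i), fun i => ?_, fun v => ?_⟩
  · rw [Module.Basis.reindex_apply, Module.Basis.unitsSMul_apply, hb, hB₀]
    rfl
  · have hrange : Set.range B₀ = s := by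
      ext x
      simp [hB₀]
    have h1 := mem_hull_range_basis B₀ v
    rw [hrange] at h1
    refine h1.trans ?_
    rw [← e.forall_congr_right]
    refine forall_congr' fun g => ?_
    rw [Module.Basis.repr_reindex_apply, Equiv.symm_apply_apply, Module.Basis.repr_unitsSMul]
    have : ((Units.mk0 (k g) (hk g).ne')⁻¹ • B₀.repr v g : ℝ) = (k g)⁻¹ * B₀.repr v g := rfl
    rw [this, mul_nonneg_iff_of_pos_left (inv_pos.2 (hk g))]

/-- The basis of `N_ℝ` formed by the vectors `b_i` in a full-dimensional cone. -/
def coneBasis (S : StackyFan N) (σ : S.FullCone) :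
    Module.Basis (Fin (Module.finrank ℤ N)) ℝ (RealSpace N) :=
  (S.exists_basis_of_fullCone σ).choose

/-- The rays of a full-dimensional cone. -/
def coneRay (S : StackyFan N) (σ : S.FullCone) : Fin (Module.finrank ℤ N) → S.Ray :=
  (S.exists_basis_of_fullCone σ).choose_spec.choose

theorem coneBasis_apply (S : StackyFan N) (σ : S.FullCone) (i : Fin (Module.finrank ℤ N)) :
    S.coneBasis σ i = toReal (S.b (S.coneRay σ i)) :=
  (S.exists_basis_of_fullCone σ).choose_spec.choose_spec.1 i

theorem mem_fullCone (S : StackyFan N) (σ : S.FullCone) (v : RealSpace N) :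
    v ∈ σ.1 ↔ ∀ i, 0 ≤ (S.coneBasis σ).repr v i :=
  (S.exists_basis_of_fullCone σ).choose_spec.choose_spec.2 v

/-! ### Generic directions and the half-open decomposition -/

/-- A vector is generic if it avoids the spans of the lower-dimensional cones and the coordinate
hyperplanes of the full-dimensional cones. -/
def IsGeneric (S : StackyFan N) (ξ : RealSpace N) : Prop :=
  (∀ σ ∈ S.cones, Submodule.span ℝ (σ : Set (RealSpace N)) ≠ ⊤ →
    ξ ∉ Submodule.span ℝ (σ : Set (RealSpace N))) ∧
  ∀ (σ : S.FullCone) (i : Fin (Module.finrank ℤ N)), (S.coneBasis σ).repr ξ i ≠ 0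

theorem IsGeneric.neg {S : StackyFan N} {ξ : RealSpace N} (h : S.IsGeneric ξ) :
    S.IsGeneric (-ξ) :=
  ⟨fun σ hσ hσ' => by simpa using h.1 σ hσ hσ', fun σ i => by simpa using h.2 σ i⟩

/-- A real vector space is not a finite union of proper subspaces. -/
theorem exists_isGeneric (S : StackyFan N) : ∃ ξ, S.IsGeneric ξ := by
  let P := {σ : PointedCone ℝ (RealSpace N) //
    σ ∈ S.cones ∧ Submodule.span ℝ (σ : Set (RealSpace N)) ≠ ⊤}
  have : Finite P := (S.finite_cones.subset fun _ h => h.1 :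
    {σ | σ ∈ S.cones ∧ Submodule.span ℝ (σ : Set (RealSpace N)) ≠ ⊤}.Finite)
  let p : P ⊕ (S.FullCone × Fin (Module.finrank ℤ N)) → Subspace ℝ (RealSpace N) :=
    Sum.elim (fun σ => Submodule.span ℝ (σ.1 : Set (RealSpace N)))
      fun x => LinearMap.ker ((S.coneBasis x.1).coord x.2)
  by_contra! hcon
  obtain ⟨x, hx⟩ := Subspace.exists_eq_top_of_iUnion_eq_univ (p := p) (by
    rw [Set.eq_univ_iff_forall]
    intro ξ
    by_contra hξ
    rw [Set.mem_iUnion] at hξ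
    push Not at hξ
    exact hcon ξ ⟨fun σ hσ hσ' => hξ (Sum.inl ⟨σ, hσ, hσ'⟩),
      fun σ i h => hξ (Sum.inr (σ, i)) h⟩)
  rcases x with σ | ⟨σ, i⟩
  · exact σ.2.2 hx
  · have h1 : S.coneBasis σ i ∈ LinearMap.ker ((S.coneBasis σ).coord i) := by
      change S.coneBasis σ i ∈ p (Sum.inr (σ, i))
      rw [hx]
      trivial
    simp at h1

open Filter Topology in
theorem eventually_add_mul_pos {a b : ℝ} (h : 0 < a ∨ 0 < b ∧ a = 0) :
    ∀ᶠ t : ℝ in 𝓝[>] 0, 0 < a + t * b := by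
  rcases h with h | ⟨hb, rfl⟩
  · have hc : Tendsto (fun t : ℝ => a + t * b) (𝓝[>] 0) (𝓝 (a + 0 * b)) :=
      (Continuous.tendsto (by fun_prop) 0).mono_left nhdsWithin_le_nhds
    exact hc.eventually_const_lt (by simpa using h)
  · filter_upwards [self_mem_nhdsWithin] with t ht
    rw [zero_add]
    exact mul_pos ht hb

/-- A cone of the fan that contains an interior point of a full-dimensional cone contains that
cone. -/
theorem fullCone_le (S : StackyFan N) (σ : S.FullCone) {τ : PointedCone ℝ (RealSpace N)}
    (hτ : τ ∈ S.cones) {z : RealSpace N} (hz : ∀ i, 0 < (S.coneBasis σ).repr z i) (hzτ : z ∈ τ) :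
    σ.1 ≤ τ := by
  intro x hx
  -- For small t > 0 the point z - t x is still in σ. As z = t x + (z - t x) lies in the face σ ∩ τ
  -- of σ, so does x.
  have h1 : ∀ᶠ t : ℝ in nhdsWithin 0 (Set.Ioi 0), ∀ i,
      0 < (S.coneBasis σ).repr z i + t * -(S.coneBasis σ).repr x i :=
    Filter.eventually_all.2 fun i => eventually_add_mul_pos (Or.inl (hz i))
  obtain ⟨t, ht, ht0⟩ := (h1.and self_mem_nhdsWithin).exists
  have hface := (S.inter_face _ σ.2.1 _ hτ).1
  have hy : z - t • x ∈ σ.1 := (S.mem_fullCone σ _).2 fun i => by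
    have := (ht i).le
    simpa [sub_eq_add_neg] using this
  have hzσ : z ∈ σ.1 := (S.mem_fullCone σ z).2 fun i => (hz i).le
  exact (hface.mem_of_smul_add_mem hx hy ht0 (by simpa using ⟨hzσ, hzτ⟩)).2

theorem FullCone.eq_of_interior {S : StackyFan N} {σ τ : S.FullCone} {z : RealSpace N}
    (hσ : ∀ i, 0 < (S.coneBasis σ).repr z i) (hτ : ∀ i, 0 < (S.coneBasis τ).repr z i) : σ = τ :=
  Subtype.ext (le_antisymm
    (S.fullCone_le σ τ.2.1 hσ ((S.mem_fullCone τ z).2 fun i => (hτ i).le))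
    (S.fullCone_le τ σ.2.1 hτ ((S.mem_fullCone σ z).2 fun i => (hσ i).le)))

/-- Moving a point a little in a generic direction leads into a full-dimensional cone. -/
theorem exists_fullCone_halfOpen (S : StackyFan N) (hS : S.IsComplete) {ξ : RealSpace N}
    (hξ : S.IsGeneric ξ) (v : RealSpace N) :
    ∃ σ : S.FullCone, ∀ i, 0 < (S.coneBasis σ).repr v i ∨
      0 < (S.coneBasis σ).repr ξ i ∧ (S.coneBasis σ).repr v i = 0 := by
  have hc : ∀ n : ℕ, ∃ σ : S.cones, v + ((n : ℝ) + 1)⁻¹ • ξ ∈ σ.1 := by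
    intro n
    have : v + ((n : ℝ) + 1)⁻¹ • ξ ∈ S.support := by
      rw [show S.support = Set.univ from hS]
      trivial
    obtain ⟨σ, hσ, h⟩ := this
    exact ⟨⟨σ, hσ⟩, h⟩
  -- Pigeonhole: one cone τ contains v + ξ/(n+1) for infinitely many n.
  choose f hf using hc
  have : Finite S.cones := S.finite_cones
  obtain ⟨τ, hτ⟩ := Finite.exists_infinite_fiber f
  have hinf : (f ⁻¹' {τ}).Infinite := Set.infinite_coe_iff.1 hτ
  have hmem : ∀ n ∈ f ⁻¹' {τ}, v + ((n : ℝ) + 1)⁻¹ • ξ ∈ τ.1 := by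
    intro n hn
    have hn' : f n = τ := hn
    rw [← hn']
    exact hf n
  -- The difference of two such points is a nonzero multiple of ξ, so a proper span would contradict
  -- genericity.
  have hspan : Submodule.span ℝ (τ.1 : Set (RealSpace N)) = ⊤ := by
    by_contra hne
    obtain ⟨m, hm⟩ := hinf.nonempty
    obtain ⟨n, hn, hmn⟩ := hinf.exists_gt m
    have h1 := Submodule.sub_mem _ (Submodule.subset_span (R := ℝ) (hmem m hm))
      (Submodule.subset_span (R := ℝ) (hmem n hn))
    rw [add_sub_add_left_eq_sub, ← sub_smul] at h1
    have h2 : ((m : ℝ) + 1)⁻¹ - ((n : ℝ) + 1)⁻¹ ≠ 0 := by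
      rw [sub_ne_zero]
      intro h
      have h3 : (m : ℝ) = n := by simpa using h
      exact hmn.ne (by exact_mod_cast h3)
    exact hξ.1 τ.1 τ.2 hne ((Submodule.smul_mem_iff _ h2).1 h1)
  let σ : S.FullCone := ⟨τ.1, τ.2, hspan⟩
  have hq : ∀ n ∈ f ⁻¹' {τ}, ∀ i,
      0 ≤ (S.coneBasis σ).repr v i + ((n : ℝ) + 1)⁻¹ * (S.coneBasis σ).repr ξ i := by
    intro n hn i
    simpa using (S.mem_fullCone σ _).1 (hmem n hn) i
  refine ⟨σ, fun i => ?_⟩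
  -- A negative coordinate of v would stay negative after adding ξ/(n+1) for large n.
  have hnn : 0 ≤ (S.coneBasis σ).repr v i := by
    by_contra! hneg
    obtain ⟨m, hm⟩ := exists_nat_gt ((S.coneBasis σ).repr ξ i / -(S.coneBasis σ).repr v i)
    obtain ⟨n, hn, hmn⟩ := hinf.exists_gt m
    have h1 := hq n hn i
    have hn1 : (0 : ℝ) < n + 1 := by positivity
    have hmn' : (m : ℝ) < n + 1 := by
      have : (m : ℝ) < n := by exact_mod_cast hmn
      linarith
    rw [div_lt_iff₀ (by linarith)] at hm
    have h2 : 0 ≤ ((n : ℝ) + 1) * (S.coneBasis σ).repr v i + (S.coneBasis σ).repr ξ i := by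
      have := mul_nonneg hn1.le h1
      rwa [mul_add, mul_inv_cancel_left₀ hn1.ne'] at this
    nlinarith
  rcases hnn.lt_or_eq with h | h
  · exact Or.inl h
  · right
    refine ⟨lt_of_le_of_ne ?_ (hξ.2 σ i).symm, h.symm⟩
    obtain ⟨n, hn⟩ := hinf.nonempty
    have h1 := hq n hn i
    rw [← h, zero_add] at h1
    exact (mul_nonneg_iff_of_pos_left (by positivity)).1 h1

/-- For uniqueness: v + tξ with t > 0 small is interior to every cone satisfying the condition, and
an interior point determines its full-dimensional cone. -/
theorem existsUnique_fullCone_halfOpen (S : StackyFan N) (hS : S.IsComplete) {ξ : RealSpace N}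
    (hξ : S.IsGeneric ξ) (v : RealSpace N) :
    ∃! σ : S.FullCone, ∀ i, 0 < (S.coneBasis σ).repr v i ∨
      0 < (S.coneBasis σ).repr ξ i ∧ (S.coneBasis σ).repr v i = 0 := by
  obtain ⟨σ, hσ⟩ := S.exists_fullCone_halfOpen hS hξ v
  refine ⟨σ, hσ, fun τ hτ => ?_⟩
  have h1 := Filter.eventually_all.2 fun i => eventually_add_mul_pos (hσ i)
  have h2 := Filter.eventually_all.2 fun i => eventually_add_mul_pos (hτ i)
  obtain ⟨t, ht1, ht2⟩ := (h1.and h2).exists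
  exact FullCone.eq_of_interior (z := v + t • ξ) (fun i => by simpa using ht2 i)
    fun i => by simpa using ht1 i

theorem exists_mem_fullCone (S : StackyFan N) (hS : S.IsComplete) (v : RealSpace N) :
    ∃ σ : S.FullCone, v ∈ σ.1 := by
  obtain ⟨ξ, hξ⟩ := S.exists_isGeneric
  obtain ⟨σ, hσ⟩ := S.exists_fullCone_halfOpen hS hξ v
  refine ⟨σ, (S.mem_fullCone σ v).2 fun i => ?_⟩
  rcases hσ i with h | h
  · exact h.le
  · exact h.2.ge

/-! ### Piecewise linear functions -/

variable {S : StackyFan N} {f : RealSpace N → ℝ}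

theorem piecewise_apply (hf : S.IsPiecewiseQLinear f) (σ : S.FullCone) {v : RealSpace N}
    (hv : v ∈ σ.1) :
    f v = ∑ i, (S.coneBasis σ).repr v i * f (toReal (S.b (S.coneRay σ i))) := by
  obtain ⟨l, -, hl⟩ := hf σ.1 σ.2.1
  have hmem : ∀ i, S.coneBasis σ i ∈ σ.1 := fun i => (S.mem_fullCone σ _).2 fun j => by
    classical
    rw [Module.Basis.repr_self, Finsupp.single_apply]
    split_ifs <;> simp
  rw [hl v hv]
  conv_lhs => rw [← (S.coneBasis σ).sum_repr v]
  simp only [map_sum, map_smul, smul_eq_mul]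
  refine Finset.sum_congr rfl fun i _ => ?_
  rw [← coneBasis_apply, hl _ (hmem i)]

theorem piecewise_smul (hS : S.IsComplete) (hf : S.IsPiecewiseQLinear f) {a : ℝ} (ha : 0 ≤ a)
    (v : RealSpace N) : f (a • v) = a * f v := by
  obtain ⟨σ, hσ⟩ := S.exists_mem_fullCone hS v
  obtain ⟨l, -, hl⟩ := hf σ.1 σ.2.1
  rw [hl _ hσ, hl _ (PointedCone.smul_mem _ ha hσ), map_smul, smul_eq_mul]

theorem piecewise_nonneg (hS : S.IsComplete) (hf : S.IsPiecewiseQLinear f)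
    (hpos : ∀ ρ, 0 < f (toReal (S.b ρ))) (v : RealSpace N) : 0 ≤ f v := by
  obtain ⟨σ, hσ⟩ := S.exists_mem_fullCone hS v
  rw [piecewise_apply hf σ hσ]
  exact Finset.sum_nonneg fun i _ => mul_nonneg ((S.mem_fullCone σ v).1 hσ i) (hpos _).le

theorem coord_le_div (hf : S.IsPiecewiseQLinear f) (hpos : ∀ ρ, 0 < f (toReal (S.b ρ)))
    (σ : S.FullCone) {v : RealSpace N} (hv : v ∈ σ.1) (i : Fin (Module.finrank ℤ N)) :
    (S.coneBasis σ).repr v i ≤ f v / f (toReal (S.b (S.coneRay σ i))) := by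
  rw [le_div_iff₀ (hpos _), piecewise_apply hf σ hv]
  exact Finset.single_le_sum
    (f := fun i => (S.coneBasis σ).repr v i * f (toReal (S.b (S.coneRay σ i))))
    (fun j _ => mul_nonneg ((S.mem_fullCone σ v).1 hv j) (hpos _).le) (Finset.mem_univ i)

theorem piecewise_eq_zero (hS : S.IsComplete) (hf : S.IsPiecewiseQLinear f)
    (hpos : ∀ ρ, 0 < f (toReal (S.b ρ))) {v : RealSpace N} (hv : f v ≤ 0) : v = 0 := by
  obtain ⟨σ, hσ⟩ := S.exists_mem_fullCone hS v
  apply (S.coneBasis σ).ext_elem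
  intro i
  rw [map_zero, Finsupp.zero_apply]
  refine le_antisymm ?_ ((S.mem_fullCone σ v).1 hσ i)
  exact (coord_le_div hf hpos σ hσ i).trans (div_nonpos_of_nonpos_of_nonneg hv (hpos _).le)

variable [Module.Finite ℤ N]

/-- Positivity on the b_i bounds every cone coordinate on a sublevel set. Applied to ψ+λ, this is
where λ(b_i) > -1 enters. -/
theorem finite_piecewise_le (hS : S.IsComplete) (hf : S.IsPiecewiseQLinear f)
    (hpos : ∀ ρ, 0 < f (toReal (S.b ρ))) (C : ℝ) : {v : N | f (toReal v) ≤ C}.Finite := by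
  refine (Set.finite_iUnion fun σ : S.FullCone => finite_lattice_box (S.coneBasis σ)
    fun i => C / f (toReal (S.b (S.coneRay σ i)))).subset fun v hv => ?_
  obtain ⟨σ, hσ⟩ := S.exists_mem_fullCone hS (toReal v)
  refine Set.mem_iUnion.2 ⟨σ, fun i => ⟨(S.mem_fullCone σ _).1 hσ i, ?_⟩⟩
  exact (coord_le_div hf hpos σ hσ i).trans (div_le_div_of_nonneg_right hv (hpos _).le)

/-! ### Common denominators -/

/-- A linear form with rational values on the lattice has bounded denominators there. -/
theorem exists_common_denominator (l : RealSpace N →ₗ[ℝ] ℝ)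
    (hl : ∀ n : N, ∃ q : ℚ, l (toReal n) = q) :
    ∃ K : ℕ, 0 < K ∧ ∀ n : N, ∃ z : ℤ, K * l (toReal n) = z := by
  let e := Module.Free.chooseBasis ℤ N
  choose q hq using fun j => hl (e j)
  refine ⟨∏ j, (q j).den, Finset.prod_pos fun j _ => (q j).den_pos, fun n => ?_⟩
  -- Integrality of the multiple is a subgroup condition, so it suffices to check it on a basis of
  -- N.
  let T : AddSubgroup N :=
    { carrier := {n | ∃ z : ℤ, ((∏ j, (q j).den : ℕ) : ℝ) * l (toReal n) = z}
      zero_mem' := ⟨0, by simp [toReal_zero]⟩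
      add_mem' := by
        rintro x y ⟨a, ha⟩ ⟨b, hb⟩
        exact ⟨a + b, by rw [toReal_add, map_add, mul_add, ha, hb]; push_cast; rfl⟩
      neg_mem' := by
        rintro x ⟨a, ha⟩
        refine ⟨-a, ?_⟩
        have : toReal (-x) = -toReal x := TensorProduct.tmul_neg _ _
        rw [this, map_neg, mul_neg, ha]
        push_cast
        rfl }
  have hT : n ∈ T := by
    rw [← e.sum_repr n]
    refine AddSubgroup.sum_mem _ fun j _ => AddSubgroup.zsmul_mem _ ?_ _
    classical
    refine ⟨(∏ i ∈ Finset.univ.erase j, ((q i).den : ℤ)) * (q j).num, ?_⟩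
    rw [hq, ← Finset.mul_prod_erase _ _ (Finset.mem_univ j)]
    have : ((q j).den : ℝ) * (q j : ℝ) = (q j).num := by
      exact_mod_cast Rat.den_mul_eq_num (q j)
    push_cast
    rw [← this]
    ring
  exact hT

theorem exists_common_denominator_piecewise (hS : S.IsComplete) (hf : S.IsPiecewiseQLinear f) :
    ∃ K : ℕ, 0 < K ∧ ∀ n : N, ∃ z : ℤ, K * f (toReal n) = z := by
  classical
  have : Fintype S.FullCone := Fintype.ofFinite _
  choose l hlq hl using fun σ : S.FullCone => hf σ.1 σ.2.1
  choose K hK hKz using fun σ => exists_common_denominator (l σ) (hlq σ)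
  refine ⟨∏ σ, K σ, Finset.prod_pos fun σ _ => hK σ, fun n => ?_⟩
  obtain ⟨σ, hσ⟩ := S.exists_mem_fullCone hS (toReal n)
  obtain ⟨z, hz⟩ := hKz σ n
  refine ⟨(∏ i ∈ Finset.univ.erase σ, (K i : ℤ)) * z, ?_⟩
  rw [hl σ _ hσ, ← Finset.mul_prod_erase _ _ (Finset.mem_univ σ)]
  push_cast
  rw [← hz]
  ring

end StackyFan

/-! ### The coefficients of the weighted `δ`-vector -/

theorem finite_support_ncard_fiber {A : Type*} {s : Set A} (hs : s.Finite) (f : A → ℕ) :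
    (Function.support fun m => (Set.ncard {v | v ∈ s ∧ f v = m} : ℤ)).Finite := by
  refine (hs.image f).subset fun m hm => ?_
  rw [Function.mem_support, Nat.cast_ne_zero] at hm
  obtain ⟨v, hv, hm⟩ := Set.nonempty_of_ncard_ne_zero hm
  exact ⟨v, hv, hm⟩

theorem sum_ncard_fiber {A : Type*} {s : Set A} (hs : s.Finite) (f : A → ℕ) (t : Finset ℕ)
    (ht : ∀ v ∈ s, f v ∈ t) :
    ∑ m ∈ t, Set.ncard {v | v ∈ s ∧ f v = m} = Set.ncard s := by
  classical
  rw [Set.ncard_eq_toFinset_card s hs,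
    Finset.card_eq_sum_card_fiberwise (f := f) (t := t) (by simpa [Set.MapsTo] using ht)]
  refine Finset.sum_congr rfl fun m _ => ?_
  rw [← Set.ncard_coe_finset]
  congr 1
  ext v
  simp

theorem finsum_ncard_fiber {A : Type*} {s : Set A} (hs : s.Finite) (f : A → ℕ) :
    ∑ᶠ m, (Set.ncard {v | v ∈ s ∧ f v = m} : ℤ) = Set.ncard s := by
  rw [finsum_eq_sum _ (finite_support_ncard_fiber hs f)]
  rw [← sum_ncard_fiber hs f (hs.image f).toFinset (by
    intro v hv
    simpa using ⟨v, hv, rfl⟩), Nat.cast_sum]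
  refine Finset.sum_subset (fun m hm => ?_) fun m _ hm => by simpa using hm
  rw [Set.Finite.mem_toFinset, Function.mem_support, Nat.cast_ne_zero] at hm
  obtain ⟨v, hv, hm⟩ := Set.nonempty_of_ncard_ne_zero hm
  simpa using ⟨v, hv, hm⟩

theorem one_sub_pow_eq_sum {R : Type*} [CommRing R] (x : R) (d : ℕ) :
    (1 - x) ^ d = ∑ i ∈ Finset.range (d + 1), (((-1) ^ i * d.choose i : ℤ) : R) * x ^ i := by
  rw [sub_eq_neg_add, add_pow]
  refine Finset.sum_congr rfl fun i _ => ?_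
  rw [neg_pow]
  push_cast
  ring

namespace StackyFan

variable {N : Type*} [AddCommGroup N] [Module.Free ℤ N]

theorem psi_piecewise (S : StackyFan N) : S.IsPiecewiseQLinear S.psi :=
  (Classical.choose_spec S.exists_psi).1

theorem psi_b (S : StackyFan N) (ρ : S.Ray) : S.psi (toReal (S.b ρ)) = 1 :=
  (Classical.choose_spec S.exists_psi).2.1 ρ

theorem psi_b_pos (S : StackyFan N) (ρ : S.Ray) : 0 < S.psi (toReal (S.b ρ)) := by
  rw [psi_b]
  exact one_pos

/-- The piecewise linear function `ψ + λ`. -/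
def total (S : StackyFan N) (lam : RealSpace N → ℝ) (v : RealSpace N) : ℝ := S.psi v + lam v

/-- The least `m` with `v ∈ mQ`. -/
def height (S : StackyFan N) (v : N) : ℕ := ⌈S.psi (toReal v)⌉₊

variable {S : StackyFan N} {lam : RealSpace N → ℝ}

theorem total_piecewise (hlam : S.IsPiecewiseQLinear lam) :
    S.IsPiecewiseQLinear (S.total lam) := by
  intro σ hσ
  obtain ⟨l, hlq, hl⟩ := S.psi_piecewise σ hσ
  obtain ⟨l', hlq', hl'⟩ := hlam σ hσ
  refine ⟨l + l', fun n => ?_, fun v hv => ?_⟩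
  · obtain ⟨q, hq⟩ := hlq n
    obtain ⟨q', hq'⟩ := hlq' n
    exact ⟨q + q', by simp [hq, hq']⟩
  · simp [total, hl v hv, hl' v hv]

theorem total_b_pos (hb : ∀ ρ : S.Ray, -1 < lam (toReal (S.b ρ))) (ρ : S.Ray) :
    0 < S.total lam (toReal (S.b ρ)) := by
  rw [total, psi_b]
  linarith [hb ρ]

theorem toReal_mem_smul_Q (hS : S.IsComplete) (m : ℕ) (v : N) :
    toReal v ∈ (m : ℝ) • S.Q ↔ S.height v ≤ m := by
  have hQ : ∀ u, u ∈ S.Q ↔ S.psi u ≤ 1 := by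
    intro u
    have : u ∈ S.support := by
      rw [show S.support = Set.univ from hS]
      trivial
    exact ⟨fun h => h.2, fun h => ⟨this, h⟩⟩
  rw [height, Nat.ceil_le]
  constructor
  · rintro ⟨u, hu, huv⟩
    simp only at huv
    rw [← huv, piecewise_smul hS S.psi_piecewise (Nat.cast_nonneg m)]
    exact mul_le_of_le_one_right (Nat.cast_nonneg m) ((hQ u).1 hu)
  · intro h
    -- For m = 0 the dilate is {0}, and ψ(v) ≤ 0 does force v = 0; division by m is available only
    -- for m > 0.
    rcases Nat.eq_zero_or_pos m with rfl | hm
    · have h0 := piecewise_eq_zero hS S.psi_piecewise S.psi_b_pos (by simpa using h)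
      have hψ0 : S.psi 0 = 0 := by
        simpa using piecewise_smul hS S.psi_piecewise le_rfl (0 : RealSpace N)
      exact ⟨0, (hQ 0).2 (by rw [hψ0]; exact zero_le_one), by simp [h0]⟩
    · have hm' : (0 : ℝ) < m := by exact_mod_cast hm
      refine ⟨(m : ℝ)⁻¹ • toReal v, (hQ _).2 ?_, smul_inv_smul₀ hm'.ne' _⟩
      rw [piecewise_smul hS S.psi_piecewise (inv_nonneg.2 hm'.le), inv_mul_le_iff₀ hm', mul_one]
      exact h

/-- Adding ⌈ψ(v)⌉ to the weight leaves (ψ+λ)(v): the ceiling disappears from the exponent of t. -/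
theorem weight_eq_iff (hS : S.IsComplete) (k : ℚ) (v : N) :
    S.weight lam v = k ↔ S.total lam (toReal v) = ((k + S.height v : ℚ) : ℝ) := by
  have h : ((⌈S.psi (toReal v)⌉ : ℤ) : ℝ) = S.height v := by
    rw [height]
    exact (natCast_ceil_eq_intCast_ceil
      (piecewise_nonneg hS S.psi_piecewise S.psi_b_pos (toReal v))).symm
  rw [weight, total, h]
  push_cast
  constructor <;> intro h <;> linarith

/-- The degree function `v ↦ M (ψ + λ)(v)`, for a common denominator `M`. -/
theorem exists_degree (hS : S.IsComplete) (hlam : S.IsPiecewiseQLinear lam)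
    (hb : ∀ ρ : S.Ray, -1 < lam (toReal (S.b ρ))) {M : ℕ}
    (hM : ∀ v : N, ∃ z : ℤ, M * S.total lam (toReal v) = z) :
    ∃ deg : N → ℕ, ∀ v, (deg v : ℝ) = M * S.total lam (toReal v) := by
  choose z hz using hM
  refine ⟨fun v => (z v).toNat, fun v => ?_⟩
  have h0 : (0 : ℝ) ≤ z v := by
    rw [← hz]
    exact mul_nonneg (Nat.cast_nonneg M)
      (piecewise_nonneg hS (total_piecewise hlam) (total_b_pos hb) _)
  rw [hz]
  exact_mod_cast Int.toNat_of_nonneg (by exact_mod_cast h0)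

variable [Module.Finite ℤ N]

theorem finite_total_eq (hS : S.IsComplete) (hlam : S.IsPiecewiseQLinear lam)
    (hb : ∀ ρ : S.Ray, -1 < lam (toReal (S.b ρ))) (x : ℝ) :
    {v : N | S.total lam (toReal v) = x}.Finite :=
  (finite_piecewise_le hS (total_piecewise hlam) (total_b_pos hb) x).subset fun _ h => h.le

theorem finite_height_le (hS : S.IsComplete) (m : ℕ) : {v : N | S.height v ≤ m}.Finite :=
  (finite_piecewise_le hS S.psi_piecewise S.psi_b_pos m).subset fun _ h => Nat.ceil_le.1 h

theorem weightCount_eq_sum (hS : S.IsComplete) (k : ℚ) (m : ℕ) :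
    S.weightCount lam k m = ∑ j ∈ Finset.range (m + 1),
      Set.ncard {v : N | S.total lam (toReal v) = ((k + j : ℚ) : ℝ) ∧ S.height v = j} := by
  have hfin : {v : N | toReal v ∈ (m : ℝ) • S.Q ∧ S.weight lam v = k}.Finite :=
    (finite_height_le hS m).subset fun v hv => (toReal_mem_smul_Q hS m v).1 hv.1
  rw [weightCount, ← sum_ncard_fiber hfin S.height (Finset.range (m + 1))]
  · refine Finset.sum_congr rfl fun j hj => ?_
    congr 1
    ext v
    simp only [Set.mem_ofPred_eq, toReal_mem_smul_Q hS, weight_eq_iff hS]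
    constructor
    · rintro ⟨⟨-, h⟩, rfl⟩
      exact ⟨h, rfl⟩
    · rintro ⟨h, rfl⟩
      exact ⟨⟨Finset.mem_range_succ_iff.1 hj, h⟩, rfl⟩
  · intro v hv
    exact Finset.mem_range_succ_iff.2 ((toReal_mem_smul_Q hS m v).1 hv.1)

/-- The counts are cumulative in m, so their series is that of the increments times 1/(1-t); this
cancels one of the d+1 factors 1-t. -/
theorem deltaPart_eq (hS : S.IsComplete) (k : ℚ) :
    S.deltaPart lam k = (1 - PowerSeries.X) ^ Module.finrank ℤ N * PowerSeries.mk fun j =>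
      (Set.ncard {v : N | S.total lam (toReal v) = ((k + j : ℚ) : ℝ) ∧ S.height v = j} : ℤ) := by
  have h : (PowerSeries.mk fun m => (S.weightCount lam k m : ℤ)) =
      (PowerSeries.mk fun j => (Set.ncard
        {v : N | S.total lam (toReal v) = ((k + j : ℚ) : ℝ) ∧ S.height v = j} : ℤ)) *
        PowerSeries.mk 1 := by
    ext n
    simp [PowerSeries.coeff_mul, Finset.Nat.sum_antidiagonal_eq_sum_range_succ_mk,
      weightCount_eq_sum hS]
  rw [deltaPart, h, pow_succ, mul_assoc, ← mul_assoc (1 - PowerSeries.X), mul_comm (1 - _),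
    mul_assoc, mul_comm (1 - _), PowerSeries.mk_one_mul_one_sub_eq_one, mul_one]

/-- Since (q - m) + (m - i) = q - i, the level of ψ+λ does not depend on m. Only the height does, so
summing over m will exhaust the level set. -/
theorem coeff_deltaPart (hS : S.IsComplete) (q : ℚ) (m : ℕ) :
    PowerSeries.coeff m (S.deltaPart lam (q - m)) =
      ∑ i ∈ Finset.range (Module.finrank ℤ N + 1),
        ((-1) ^ i * (Module.finrank ℤ N).choose i : ℤ) *
          (Set.ncard {v : N | v ∈ {v : N | S.total lam (toReal v) = ((q - i : ℚ) : ℝ)} ∧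
            S.height v + i = m} : ℤ) := by
  rw [deltaPart_eq hS, one_sub_pow_eq_sum, Finset.sum_mul, map_sum]
  refine Finset.sum_congr rfl fun i _ => ?_
  rw [mul_assoc, ← map_intCast (PowerSeries.C (R := ℤ)), PowerSeries.coeff_C_mul,
    PowerSeries.coeff_X_pow_mul', Int.cast_id]
  congr 1
  split_ifs with h
  · rw [PowerSeries.coeff_mk]
    congr 2
    ext v
    simp only [Set.mem_ofPred_eq]
    have h1 : q - m + ((m - i : ℕ) : ℚ) = q - i := by
      rw [Nat.cast_sub h]
      ring
    rw [h1]
    refine and_congr_right fun _ => ?_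
    omega
  · symm
    rw [Nat.cast_eq_zero]
    convert Set.ncard_empty N
    rw [Set.eq_empty_iff_forall_notMem]
    rintro v ⟨-, hv⟩
    omega

theorem finite_coeff_deltaPart (hS : S.IsComplete) (hlam : S.IsPiecewiseQLinear lam)
    (hb : ∀ ρ : S.Ray, -1 < lam (toReal (S.b ρ))) (q : ℚ) :
    {m : ℕ | PowerSeries.coeff m (S.deltaPart lam (q - m)) ≠ 0}.Finite := by
  refine ((Finset.range (Module.finrank ℤ N + 1)).finite_toSet.biUnion fun i _ =>
    finite_support_ncard_fiber (finite_total_eq hS hlam hb ((q - i : ℚ) : ℝ))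
      fun v => S.height v + i).subset fun m hm => ?_
  simp only [Set.mem_ofPred_eq] at hm
  rw [coeff_deltaPart hS] at hm
  obtain ⟨i, hi, h⟩ := Finset.exists_ne_zero_of_sum_ne_zero hm
  exact Set.mem_biUnion hi (right_ne_zero_of_mul h)

/-- This is δ^λ(t) = (1-t)^d ∑ t^((ψ+λ)(v)), coefficient by coefficient; the heights are summed out.
-/
theorem delta_eq_sum (hS : S.IsComplete) (hlam : S.IsPiecewiseQLinear lam)
    (hb : ∀ ρ : S.Ray, -1 < lam (toReal (S.b ρ))) (q : ℚ) :
    S.delta lam q = ∑ i ∈ Finset.range (Module.finrank ℤ N + 1),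
      ((-1) ^ i * (Module.finrank ℤ N).choose i : ℤ) *
        (Set.ncard {v : N | S.total lam (toReal v) = ((q - i : ℚ) : ℝ)} : ℤ) := by
  have hfin := fun i : ℕ => finite_total_eq hS hlam hb ((q - i : ℚ) : ℝ)
  simp only [delta, coeff_deltaPart hS]
  rw [finsum_sum_comm]
  · refine Finset.sum_congr rfl fun i _ => ?_
    rw [← mul_finsum, finsum_ncard_fiber (hfin i)]
  · intro i _
    refine (finite_support_ncard_fiber (hfin i) fun v => S.height v + i).subset fun m hm => ?_
    exact right_ne_zero_of_mul hm

/-! ### Reciprocity for the fan and the functional equation -/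

/-- The full-dimensional cones of the fan, with the degree function `v ↦ M (ψ + λ)(v)`. -/
def chamber (hlam : S.IsPiecewiseQLinear lam)
    (hb : ∀ ρ : S.Ray, -1 < lam (toReal (S.b ρ))) {M : ℕ} (hM : 0 < M) {deg : N → ℕ}
    (hdeg : ∀ v, (deg v : ℝ) = M * S.total lam (toReal v)) (σ : S.FullCone) :
    Chamber N deg (Fin (Module.finrank ℤ N)) where
  coord :=
    { toFun := fun v => (S.coneBasis σ).repr (toReal v)
      map_zero' := by
        rw [toReal_zero, map_zero]
        rfl
      map_add' := fun x y => by
        rw [toReal_add, map_add]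
        rfl }
  gen := fun i => S.b (S.coneRay σ i)
  coord_gen := fun i => by
    change ⇑((S.coneBasis σ).repr (toReal (S.b (S.coneRay σ i)))) = _
    rw [← coneBasis_apply, Module.Basis.repr_self, Finsupp.single_eq_pi_single]
  deg_eq := fun v hv => by
    change (deg v : ℝ) = ∑ i, (S.coneBasis σ).repr (toReal v) i * _
    rw [hdeg, piecewise_apply (total_piecewise hlam) σ ((S.mem_fullCone σ _).2 hv),
      Finset.mul_sum]
    refine Finset.sum_congr rfl fun i _ => ?_
    rw [hdeg]
    ring
  deg_pos := fun i => by
    have h : (0 : ℝ) < deg (S.b (S.coneRay σ i)) := by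
      rw [hdeg]
      exact mul_pos (by exact_mod_cast hM) (total_b_pos hb _)
    exact_mod_cast h
  finite_box := finite_lattice_box (S.coneBasis σ) fun _ => 1

theorem exists_ratFunc_genSeries (hS : S.IsComplete) (hlam : S.IsPiecewiseQLinear lam)
    (hb : ∀ ρ : S.Ray, -1 < lam (toReal (S.b ρ))) {M : ℕ} (hM : 0 < M) {deg : N → ℕ}
    (hdeg : ∀ v, (deg v : ℝ) = M * S.total lam (toReal v)) :
    ∃ R : RatFunc ℚ, (R : ℚ⸨X⸩) = (genSeries deg (Set.univ : Set N) : ℚ⸨X⸩) ∧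
      substHom _ transcendental_X_inv R = (-1) ^ Module.finrank ℤ N * R := by
  have : Fintype S.FullCone := Fintype.ofFinite _
  obtain ⟨ξ, hξ⟩ := S.exists_isGeneric
  have hfin : ∀ n, {v | deg v = n}.Finite := by
    intro n
    refine (finite_total_eq hS hlam hb (n / M)).subset fun v hv => ?_
    have hM' : (M : ℝ) ≠ 0 := by exact_mod_cast hM.ne'
    rw [Set.mem_ofPred_eq, eq_div_iff hM', mul_comm, ← hdeg, show deg v = n from hv]
  have key := exists_ratFunc_genSeries_univ hfin (fun σ => chamber hlam hb hM hdeg σ)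
    (fun σ => {i | 0 < (S.coneBasis σ).repr ξ i})
    (fun v => S.existsUnique_fullCone_halfOpen hS hξ (toReal v)) (fun v => by
      -- No cone coordinate of ξ vanishes, so the positive coordinates of -ξ are exactly the
      -- complement of those of ξ.
      have h := S.existsUnique_fullCone_halfOpen hS hξ.neg (toReal v)
      have hiff : ∀ σ : S.FullCone, (∀ i, 0 < (S.coneBasis σ).repr (toReal v) i ∨
          0 < (S.coneBasis σ).repr (-ξ) i ∧ (S.coneBasis σ).repr (toReal v) i = 0) ↔
          v ∈ (chamber hlam hb hM hdeg σ).halfOpen {i | 0 < (S.coneBasis σ).repr ξ i}ᶜ := by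
        intro σ
        refine forall_congr' fun i => or_congr Iff.rfl (and_congr ?_ Iff.rfl)
        rw [map_neg, Finsupp.neg_apply, Left.neg_pos_iff, Set.mem_compl_iff, Set.mem_ofPred_eq,
          not_lt]
        exact ⟨le_of_lt, fun h => lt_of_le_of_ne h (hξ.2 σ i)⟩
      exact (existsUnique_congr hiff).1 h)
  simpa using key

theorem exists_eq_of_delta_ne_zero (hS : S.IsComplete) (hlam : S.IsPiecewiseQLinear lam)
    (hb : ∀ ρ : S.Ray, -1 < lam (toReal (S.b ρ))) {M : ℕ} (hM : 0 < M) {deg : N → ℕ}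
    (hdeg : ∀ v, (deg v : ℝ) = M * S.total lam (toReal v)) {q : ℚ} (hq : S.delta lam q ≠ 0) :
    ∃ n : ℕ, q = n / M := by
  have hM' : (M : ℚ) ≠ 0 := by exact_mod_cast hM.ne'
  rw [delta_eq_sum hS hlam hb] at hq
  obtain ⟨i, -, h⟩ := Finset.exists_ne_zero_of_sum_ne_zero hq
  obtain ⟨v, hv⟩ := Set.nonempty_of_ncard_ne_zero (Nat.cast_ne_zero.1 (right_ne_zero_of_mul h))
  have h1 := hdeg v
  rw [show S.total lam (toReal v) = _ from hv] at h1
  have h2 : (deg v : ℚ) = M * (q - i) := by exact_mod_cast h1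
  refine ⟨deg v + M * i, ?_⟩
  rw [eq_div_iff hM']
  push_cast
  rw [h2]
  ring

theorem coeff_one_sub_pow_mul_genSeries (hS : S.IsComplete) (hlam : S.IsPiecewiseQLinear lam)
    (hb : ∀ ρ : S.Ray, -1 < lam (toReal (S.b ρ))) {M : ℕ} (hM : 0 < M) {deg : N → ℕ}
    (hdeg : ∀ v, (deg v : ℝ) = M * S.total lam (toReal v)) (n : ℕ) :
    PowerSeries.coeff (R := ℚ) n ((1 - PowerSeries.X ^ M) ^ Module.finrank ℤ N *
      genSeries deg (Set.univ : Set N)) = S.delta lam (n / M) := by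
  have hM' : (M : ℚ) ≠ 0 := by exact_mod_cast hM.ne'
  rw [delta_eq_sum hS hlam hb, one_sub_pow_eq_sum, Finset.sum_mul, map_sum, Int.cast_sum]
  refine Finset.sum_congr rfl fun i _ => ?_
  rw [mul_assoc, ← map_intCast (PowerSeries.C (R := ℚ)), PowerSeries.coeff_C_mul, ← pow_mul,
    PowerSeries.coeff_X_pow_mul', Int.cast_mul (_ * _) _, Int.cast_natCast]
  congr 1
  -- Multiplying by M converts levels of ψ+λ into degrees, and the shift by i into one by M i,
  -- matching X^(M i).
  have hiff : ∀ v : N, S.total lam (toReal v) = (((n : ℚ) / M - i : ℚ) : ℝ) ↔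
      deg v + M * i = n := by
    intro v
    have hMR : (M : ℝ) ≠ 0 := by exact_mod_cast hM.ne'
    rw [← mul_right_inj' hMR, ← hdeg, ← @Nat.cast_inj ℝ]
    push_cast
    rw [mul_sub, mul_div_cancel₀ _ hMR, eq_sub_iff_add_eq]
  simp only [hiff]
  split_ifs with h
  · rw [genSeries, PowerSeries.coeff_mk]
    congr 2
    ext v
    simp only [Set.mem_univ, true_and, Set.mem_ofPred_eq]
    omega
  · symm
    rw [Nat.cast_eq_zero]
    convert Set.ncard_empty N
    rw [Set.eq_empty_iff_forall_notMem]
    intro v hv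
    have hv' : deg v + M * i = n := hv
    omega

open scoped RatFunc in
/-- For every common denominator `M` of `ψ + λ`, the weighted `δ`-vector is the expansion of a
rational function in `t^(1/M)` that satisfies the functional equation. -/
theorem exists_expansion (hS : S.IsComplete) (hlam : S.IsPiecewiseQLinear lam)
    (hb : ∀ ρ : S.Ray, -1 < lam (toReal (S.b ρ))) {M : ℕ} (hM : 0 < M)
    (hz : ∀ v : N, ∃ z : ℤ, M * S.total lam (toReal v) = z) :
    ∃ R : RatFunc ℚ, IsExpansion (S.delta lam) M R ∧
      R = RatFunc.X ^ (M * Module.finrank ℤ N) * substHom _ transcendental_X_inv R := by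
  obtain ⟨deg, hdeg⟩ := exists_degree hS hlam hb hz
  obtain ⟨R, hR, hRinv⟩ := exists_ratFunc_genSeries hS hlam hb hM hdeg
  refine ⟨(1 - RatFunc.X ^ M) ^ Module.finrank ℤ N * R, ⟨hM, fun q hq =>
    exists_eq_of_delta_ne_zero hS hlam hb hM hdeg hq, fun n => ?_⟩, ?_⟩
  · have h : (((1 - RatFunc.X ^ M) ^ Module.finrank ℤ N * R : RatFunc ℚ) : ℚ⸨X⸩) =
        (((1 - PowerSeries.X ^ M) ^ Module.finrank ℤ N *
          genSeries deg (Set.univ : Set N) : PowerSeries ℚ) : ℚ⸨X⸩) := by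
      rw [map_mul, hR]
      simp
    rw [h, PowerSeries.coeff_coe]
    split_ifs with hn
    · by_contra h0
      have h1 : S.delta lam ((n : ℚ) / M) ≠ 0 := fun h2 => h0 (by rw [h2]; simp)
      obtain ⟨k, hk⟩ := exists_eq_of_delta_ne_zero hS hlam hb hM hdeg h1
      have hM' : (M : ℚ) ≠ 0 := by exact_mod_cast hM.ne'
      rw [div_left_inj' hM'] at hk
      have : n = k := by exact_mod_cast hk
      omega
    · rw [coeff_one_sub_pow_mul_genSeries hS hlam hb hM hdeg]
      have : ((n.natAbs : ℤ) : ℚ) = n := by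
        rw [Int.natAbs_of_nonneg (not_lt.1 hn)]
      rw [← this, Int.cast_natCast]
  -- Since X^M (1 - X^(-M)) = -(1 - X^M), the d-th power absorbs the sign (-1)^d of the reciprocity
  -- law.
  · rw [map_mul, hRinv, map_pow, map_sub, map_one, map_pow, substHom_X, pow_mul, ← mul_assoc,
      ← mul_assoc, ← mul_pow, ← mul_pow]
    congr 2
    rw [mul_sub, ← mul_pow, mul_inv_cancel₀ RatFunc.X_ne_zero, one_pow]
    ring

end StackyFan

end WeightedEhrhart

end

/-- The identity `δ^λ(t) = t^d δ^λ(t⁻¹)` is one of rational functions in `x = t^(1/M)`. -/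
theorem corollary2p9 {N : Type*} [AddCommGroup N] [Module.Free ℤ N] [Module.Finite ℤ N]
    (S : WeightedEhrhart.StackyFan N) (hS : S.IsComplete)
    (lam : WeightedEhrhart.RealSpace N → ℝ) (hlam : S.IsPiecewiseQLinear lam)
    (hb : ∀ ρ : S.Ray, -1 < lam (WeightedEhrhart.toReal (S.b ρ))) :
    (∀ q : ℚ, {m : ℕ | PowerSeries.coeff m (S.deltaPart lam (q - m)) ≠ 0}.Finite) ∧
    (∃ (M : ℕ) (R : RatFunc ℚ), WeightedEhrhart.IsExpansion (S.delta lam) M R) ∧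
    ∀ (M : ℕ) (R : RatFunc ℚ), WeightedEhrhart.IsExpansion (S.delta lam) M R →
      R = RatFunc.X ^ (M * Module.finrank ℤ N) * R.eval RatFunc.C RatFunc.X⁻¹ := by
  obtain ⟨K, hK, hz⟩ := WeightedEhrhart.StackyFan.exists_common_denominator_piecewise hS
    (WeightedEhrhart.StackyFan.total_piecewise hlam)
  refine ⟨WeightedEhrhart.StackyFan.finite_coeff_deltaPart hS hlam hb, ?_, fun M R hR => ?_⟩
  · obtain ⟨R, hR, -⟩ := WeightedEhrhart.StackyFan.exists_expansion hS hlam hb hK hz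
    exact ⟨K, R, hR⟩
  -- The given M need not be a common denominator of ψ+λ, but KM is one.
  · have hz' : ∀ v : N, ∃ z : ℤ,
        ((K * M : ℕ) : ℝ) * S.total lam (WeightedEhrhart.toReal v) = z := by
      intro v
      obtain ⟨z, hz⟩ := hz v
      refine ⟨M * z, ?_⟩
      push_cast
      rw [← hz]
      ring
    obtain ⟨R', hR', hinv⟩ := WeightedEhrhart.StackyFan.exists_expansion hS hlam hb
      (Nat.mul_pos hK hR.1) hz'
    exact hR.functional_equation hK hR' hinv
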